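/- Let $0<a<\tfrac16$ and let $F:\mathbb R^2\to\mathbb R^2$ be the map $$F(x,y)=(x+2a\sin x+a\sin y,\; y+a\sin x+2a\sin y).$$ For a fixed point $p$ of $F$ let $W^u(p)$ be the set of points $z$ having a backward orbit $z=X_0,X_1,X_2,\dots$, $F(X_{n+1})=X_n$, with $X_n\to p$, and let $W^s(p)=\{z: F^n(z)\to p\}$. Let $$s_2=\{(x,y): x-\pi\le y\le x,\ -x+\pi\le y\le -x+2\pi\}.$$ Then $(\pi,0)$ is a saddle of $F$ (a fixed point at which $DF$ has one eigenvalue of modulus less than $1$ and one of modulus greater than $1$), $(\pi,\pi)$ is a sink (a fixed point at which all eigenvalues of $DF$ have modulus less than $1$), and $F(s_2)\subseteq s_2$. There is a heteroclinic curve $C$ from $(\pi,0)$ to $(\pi,\pi)$, that is, a set $C\subseteq W^u(\pi,0)\cap W^s(\pi,\pi)$ with $F(C)=C$ which is the image of an injective $C^\infty$ immersion $\gamma:\mathbb R\to\mathbb R^2$ with $\gamma(t)\to(\pi,0)$ as $t\to-\infty$ and $\gamma(t)\to(\pi,\pi)$ as $t\to+\infty$. Moreover $C$ is the unstable branch of the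 saddle that lies in $s_2$: the set $W^u(\pi,0)$ is the image of an injective $C^\infty$ immersion $\sigma:\mathbb R\to\mathbb R^2$ with $\sigma(0)=(\pi,0)$ and $\sigma'(0)=(2-\sqrt3,1)$ (the unstable eigenvector), $C=\sigma((0,\infty))$, and $C=(W^u(\pi,0)\cap s_2)\setminus\{(\pi,0)\}$. -/

import Mathlib

open Filter Topology
open scoped ContDiff

namespace AlignedClocks

/-- The map of the phase differences of three aligned clocks with nearest-neighbour coupling `a`. -/
noncomputable def clockMap (a : ℝ) (z : ℝ × ℝ) : ℝ × ℝ :=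
  (z.1 + 2 * a * Real.sin z.1 + a * Real.sin z.2,
   z.2 + a * Real.sin z.1 + 2 * a * Real.sin z.2)

/-- The small square with bottom vertex `(π, 0)` and top vertex `(π, π)`. -/
def smallSquare : Set (ℝ × ℝ) :=
  {z | z.1 - Real.pi ≤ z.2 ∧ z.2 ≤ z.1 ∧ -z.1 + Real.pi ≤ z.2 ∧ z.2 ≤ -z.1 + 2 * Real.pi}

/-- The complex eigenvalues of the derivative of `F` at `p`. -/
noncomputable def multipliers (F : ℝ × ℝ → ℝ × ℝ) (p : ℝ × ℝ) : Multiset ℂ :=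
  (LinearMap.charpoly (fderiv ℝ F p : (ℝ × ℝ) →ₗ[ℝ] (ℝ × ℝ))).aroots ℂ

/-- `p` is a hyperbolic fixed point of `F` with one contracting and one expanding eigenvalue. -/
def IsSaddle (F : ℝ × ℝ → ℝ × ℝ) (p : ℝ × ℝ) : Prop :=
  F p = p ∧ DifferentiableAt ℝ F p ∧
    (∃ μ ∈ multipliers F p, ‖μ‖ < 1) ∧ (∃ μ ∈ multipliers F p, 1 < ‖μ‖)

/-- `p` is a fixed point of `F` at which all eigenvalues are contracting. -/
def IsSink (F : ℝ × ℝ → ℝ × ℝ) (p : ℝ × ℝ) : Prop :=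
  F p = p ∧ DifferentiableAt ℝ F p ∧ ∀ μ ∈ multipliers F p, ‖μ‖ < 1

/-- The global stable set of `p`: the points whose forward orbit converges to `p`. -/
def stableSet (F : ℝ × ℝ → ℝ × ℝ) (p : ℝ × ℝ) : Set (ℝ × ℝ) :=
  {z | Tendsto (fun n : ℕ => F^[n] z) atTop (𝓝 p)}

/-- The global unstable set of `p`: the points with a backward orbit that converges to `p`
(for invertible `F` the backward orbit is unique). -/
def unstableSet (F : ℝ × ℝ → ℝ × ℝ) (p : ℝ × ℝ) : Set (ℝ × ℝ) :=
  {z | ∃ X : ℕ → ℝ × ℝ, X 0 = z ∧ (∀ n, F (X (n + 1)) = X n) ∧ Tendsto X atTop (𝓝 p)}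

/-- `γ` is an injective smooth immersion of the real line. -/
def IsSmoothSimpleCurve (γ : ℝ → ℝ × ℝ) : Prop :=
  ContDiff ℝ ∞ γ ∧ Function.Injective γ ∧ ∀ t, deriv γ t ≠ 0

/-- `C` is a heteroclinic curve of `F` from `p` to `q`: a smooth simple curve with `F(C) = C` that
runs from `p` to `q`, and whose points all have backward orbits converging to `p` and forward
orbits converging to `q`. -/
def IsHeteroclinicCurve (F : ℝ × ℝ → ℝ × ℝ) (p q : ℝ × ℝ) (C : Set (ℝ × ℝ)) : Prop :=
  F '' C = C ∧ C ⊆ unstableSet F p ∩ stableSet F q ∧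
    ∃ γ : ℝ → ℝ × ℝ, IsSmoothSimpleCurve γ ∧ Set.range γ = C ∧
      Tendsto γ atBot (𝓝 p) ∧ Tendsto γ atTop (𝓝 q)

/-- `C` is the branch, in the direction `v`, of the one-dimensional unstable manifold of `p`:
the unstable set of `p` is a smooth simple curve through `p` with velocity `v` there, and `C` is
the part of it on the positive side of `p`. -/
def IsUnstableBranch (F : ℝ × ℝ → ℝ × ℝ) (p v : ℝ × ℝ) (C : Set (ℝ × ℝ)) : Prop :=
  ∃ γ : ℝ → ℝ × ℝ, IsSmoothSimpleCurve γ ∧ γ 0 = p ∧ deriv γ 0 = v ∧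
    Set.range γ = unstableSet F p ∧ γ '' Set.Ioi 0 = C

end AlignedClocks

/-! Let `l = 1 + √3 a` and `v = (2 - √3, 1)` be the unstable eigenpair at the saddle `p`. The points
`F^n (p + (t / l^n) v)` converge to `σ t`, a global parametrization of the unstable manifold with `F
(σ t) = σ (l t)`. Consecutive approximations differ by a quadratic error in `t`, so it suffices that
`F` has a local Lipschitz constant below `l^2`. The construction is done over `ℂ`, where locally
uniform limits are holomorphic, so smoothness comes with convergence (`exists_entire_curve`).

The functional equation reduces global claims to `t` near `0`. Injectivity and immersion are pulled
back to `0` because `F` and its derivative are injective for `3a < 1`. That `σ` fills the whole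
unstable set is a cone argument (`unstableSet_subset_range`): a backward orbit off the curve would
separate from it geometrically.

In coordinates along the sides of the square, `F` adds nonnegative increments smaller than the
distance to the upper edges (`leftCoord_clockMap`, `rightCoord_clockMap`). Hence the square is
invariant, and points away from the two lower edges contract uniformly to the sink. The vector `v`
points strictly into the square, so the positive branch lies there and tends to the sink; reflection
in `p` puts the other branch outside. -/

namespace AlignedClocks

/-! ### Linearizing parametrization of an unstable curve -/

section Linearization

variable {E : Type*} [NormedAddCommGroup E] [NormedSpace ℂ E]

/-- The approximations `G^[n] (p + (t / l ^ n) • v)` of the unstable curve of `G` at `p`. -/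
noncomputable def curveApprox (G : E → E) (p v : E) (l : ℝ) (n : ℕ) (t : ℂ) : E :=
  G^[n] (p + (t / (l : ℂ) ^ n) • v)

lemma curveApprox_add (G : E → E) (p v : E) (l : ℝ) (n k : ℕ) (t : ℂ) :
    curveApprox G p v l (n + k) t = G^[k] (curveApprox G p v l n (t / (l : ℂ) ^ k)) := by
  unfold curveApprox
  rw [← Function.iterate_add_apply, add_comm n k, div_div, pow_add]

lemma curveApprox_succ (G : E → E) (p v : E) (l : ℝ) (n : ℕ) (t : ℂ) :
    curveApprox G p v l (n + 1) t = G (curveApprox G p v l n (t / (l : ℂ))) := by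
  rw [curveApprox_add]; simp

lemma differentiable_curveApprox {G : E → E} (hG : Differentiable ℂ G) (p v : E) (l : ℝ) (n : ℕ) :
    Differentiable ℂ (curveApprox G p v l n) :=
  (hG.iterate n).comp (((differentiable_id.div_const _).smul_const v).const_add p)

lemma norm_div_ofReal_le {l : ℝ} (hl : 1 < l) (t : ℂ) : ‖t / (l : ℂ)‖ ≤ ‖t‖ := by
  rw [norm_div, Complex.norm_real, Real.norm_eq_abs, abs_of_pos (by linarith)]
  exact div_le_self (norm_nonneg _) hl.le

/-- Passing from `n` to `n + 1` rescales `t` by `1 / l`, gaining `l^2` in a quadratic bound, and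
applies `G`, costing `μ`: the ratio is `μ / l^2 < 1`. The two bounds are proved together because the
first keeps the approximations in the ball where `hLip` applies. -/
lemma curveApprox_estimates {G : E → E} {p v : E} {l μ K ρ δ : ℝ} (hl : 1 < l) (hμ0 : 0 ≤ μ)
    (hμ : μ < l ^ 2) (hK0 : 0 ≤ K)
    (hLip : ∀ z w, ‖z - p‖ ≤ ρ → ‖w - p‖ ≤ ρ → ‖G z - G w‖ ≤ μ * ‖z - w‖)
    (hK : ∀ t : ℂ, ‖t‖ ≤ δ → ‖G (p + t • v) - (p + ((l : ℂ) * t) • v)‖ ≤ K * ‖t‖ ^ 2)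
    (hδ : δ * ‖v‖ + K * (1 - μ / l ^ 2)⁻¹ * δ ^ 2 ≤ ρ) (n : ℕ) :
    (∀ t : ℂ, ‖t‖ ≤ δ → ‖curveApprox G p v l n t - (p + t • v)‖
        ≤ (∑ k ∈ Finset.range n, (μ / l ^ 2) ^ k) * (K * ‖t‖ ^ 2)) ∧
    (∀ t : ℂ, ‖t‖ ≤ δ → ‖curveApprox G p v l (n + 1) t - curveApprox G p v l n t‖
        ≤ (μ / l ^ 2) ^ n * (K * ‖t‖ ^ 2)) := by
  have hl0 : 0 < l := by linarith
  have hlC : (l : ℂ) ≠ 0 := by exact_mod_cast hl0.ne'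
  set θ := μ / l ^ 2 with hθ
  have hθ0 : 0 ≤ θ := by positivity
  have hθ1 : θ < 1 := by rw [hθ, div_lt_one (by positivity)]; exact hμ
  have hnorm : ∀ t : ℂ, ‖t / (l : ℂ)‖ = ‖t‖ / l := fun t => by
    rw [norm_div, Complex.norm_real, Real.norm_eq_abs, abs_of_pos hl0]
  have hball : ∀ m, (∀ t : ℂ, ‖t‖ ≤ δ → ‖curveApprox G p v l m t - (p + t • v)‖
      ≤ (∑ k ∈ Finset.range m, θ ^ k) * (K * ‖t‖ ^ 2)) →
      ∀ t : ℂ, ‖t‖ ≤ δ → ‖curveApprox G p v l m t - p‖ ≤ ρ := by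
    intro m hm t ht
    have hs : ∑ k ∈ Finset.range m, θ ^ k ≤ (1 - θ)⁻¹ := by
      rw [← tsum_geometric_of_lt_one hθ0 hθ1]
      exact (summable_geometric_of_lt_one hθ0 hθ1).sum_le_tsum _ (fun _ _ => by positivity)
    have h1 : ‖curveApprox G p v l m t - p‖
        ≤ ‖curveApprox G p v l m t - (p + t • v)‖ + ‖t‖ * ‖v‖ := by
      have : curveApprox G p v l m t - p
          = (curveApprox G p v l m t - (p + t • v)) + t • v := by abel
      rw [this, ← norm_smul]; exact norm_add_le _ _
    have h2 : ‖t‖ ^ 2 ≤ δ ^ 2 := by gcongr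
    have h3 : (∑ k ∈ Finset.range m, θ ^ k) * (K * ‖t‖ ^ 2) ≤ (1 - θ)⁻¹ * (K * δ ^ 2) := by
      gcongr
    have h4 : ‖t‖ * ‖v‖ ≤ δ * ‖v‖ := by gcongr
    have := hm t ht
    nlinarith
  induction n with
  | zero =>
    refine ⟨fun t _ => by simp [curveApprox], fun t ht => ?_⟩
    have h := hK (t / l) ((norm_div_ofReal_le hl t).trans ht)
    rw [mul_div_cancel₀ _ hlC] at h
    have h0 : curveApprox G p v l (0 + 1) t - curveApprox G p v l 0 t
        = G (p + (t / l : ℂ) • v) - (p + t • v) := by simp [curveApprox]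
    rw [h0, pow_zero, one_mul]
    refine h.trans ?_
    gcongr
    exact norm_div_ofReal_le hl t
  | succ n ih =>
    have hA : ∀ t : ℂ, ‖t‖ ≤ δ → ‖curveApprox G p v l (n + 1) t - (p + t • v)‖
        ≤ (∑ k ∈ Finset.range (n + 1), θ ^ k) * (K * ‖t‖ ^ 2) := by
      intro t ht
      rw [Finset.sum_range_succ, add_mul]
      have : curveApprox G p v l (n + 1) t - (p + t • v)
          = (curveApprox G p v l n t - (p + t • v))
            + (curveApprox G p v l (n + 1) t - curveApprox G p v l n t) := by abel
      rw [this]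
      exact (norm_add_le _ _).trans (add_le_add (ih.1 t ht) (ih.2 t ht))
    refine ⟨hA, fun t ht => ?_⟩
    have ht' := (norm_div_ofReal_le hl t).trans ht
    rw [curveApprox_succ G p v l (n + 1) t, curveApprox_succ G p v l n t]
    refine (hLip _ _ (hball _ hA _ ht') (hball _ ih.1 _ ht')).trans ?_
    calc μ * ‖curveApprox G p v l (n + 1) (t / l) - curveApprox G p v l n (t / l)‖
        ≤ μ * (θ ^ n * (K * ‖t / (l : ℂ)‖ ^ 2)) := by gcongr; exact ih.2 _ ht'
      _ = θ ^ (n + 1) * (K * ‖t‖ ^ 2) := by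
        rw [hnorm, pow_succ, div_pow]
        calc _ = μ / l ^ 2 * (θ ^ n * (K * ‖t‖ ^ 2)) := by ring
          _ = _ := by rw [← hθ]; ring

/-- The local unstable curve of `G` at `p`, for an eigenvector `v` with eigenvalue `l > 1` and a
local Lipschitz constant of `G` below `l ^ 2`. -/
lemma exists_local_curve [CompleteSpace E] {G : E → E} (hG : Differentiable ℂ G)
    {p v : E} {l μ K ρ d : ℝ} (hl : 1 < l) (hμ0 : 0 ≤ μ) (hμ : μ < l ^ 2) (hK0 : 0 ≤ K)
    (hρ : 0 < ρ) (hd : 0 < d)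
    (hLip : ∀ z w, ‖z - p‖ ≤ ρ → ‖w - p‖ ≤ ρ → ‖G z - G w‖ ≤ μ * ‖z - w‖)
    (hK : ∀ t : ℂ, ‖t‖ ≤ d → ‖G (p + t • v) - (p + ((l : ℂ) * t) • v)‖ ≤ K * ‖t‖ ^ 2) :
    ∃ δ > 0, ∃ C : ℝ, ∃ f : ℂ → E, DifferentiableOn ℂ f (Metric.ball 0 δ) ∧
      (∀ t ∈ Metric.ball (0 : ℂ) δ, ‖f t - (p + t • v)‖ ≤ C * ‖t‖ ^ 2) ∧
      ∀ t ∈ Metric.ball (0 : ℂ) δ,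
        Tendsto (fun n => curveApprox G p v l n t) atTop (𝓝 (f t)) := by
  have hl0 : 0 < l := by linarith
  set θ := μ / l ^ 2 with hθ
  have hθ0 : 0 ≤ θ := by positivity
  have hθ1 : θ < 1 := by rw [hθ, div_lt_one (by positivity)]; exact hμ
  obtain ⟨δ, hδ0, hδd, hδ⟩ : ∃ δ > 0, δ ≤ d ∧ δ * ‖v‖ + K * (1 - θ)⁻¹ * δ ^ 2 ≤ ρ := by
    have hc : Continuous fun δ : ℝ => δ * ‖v‖ + K * (1 - θ)⁻¹ * δ ^ 2 := by fun_prop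
    have h1 : ∀ᶠ δ in 𝓝 (0 : ℝ), δ * ‖v‖ + K * (1 - θ)⁻¹ * δ ^ 2 < ρ :=
      hc.continuousAt.eventually_lt continuousAt_const (by simpa using hρ)
    have h2 : ∀ᶠ δ in 𝓝 (0 : ℝ), δ < d := eventually_lt_nhds hd
    obtain ⟨δ, hδ, h⟩ := ((h1.and h2).filter_mono nhdsWithin_le_nhds).and
      (self_mem_nhdsWithin : Set.Ioi (0 : ℝ) ∈ 𝓝[>] 0) |>.exists
    exact ⟨δ, h, hδ.2.le, hδ.1.le⟩
  have est := curveApprox_estimates hl hμ0 hμ hK0 hLip (fun t ht => hK t (ht.trans hδd)) hδ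
  have step : ∀ t : ℂ, ‖t‖ ≤ δ → ∀ n, dist (curveApprox G p v l n t)
      (curveApprox G p v l (n + 1) t) ≤ (K * ‖t‖ ^ 2) * θ ^ n := by
    intro t ht n
    rw [dist_comm, dist_eq_norm, mul_comm]
    exact (est n).2 t ht
  have lim : ∀ t : ℂ, ∃ y, ‖t‖ ≤ δ → Tendsto (fun n => curveApprox G p v l n t) atTop (𝓝 y) := by
    intro t
    by_cases ht : ‖t‖ ≤ δ
    · obtain ⟨y, hy⟩ := cauchySeq_tendsto_of_complete (cauchySeq_of_le_geometric _ _ hθ1 (step t ht))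
      exact ⟨y, fun _ => hy⟩
    · exact ⟨0, fun h => absurd h ht⟩
  choose f hf using lim
  have memle : ∀ t ∈ Metric.ball (0 : ℂ) δ, ‖t‖ ≤ δ := fun t ht => (mem_ball_zero_iff.1 ht).le
  refine ⟨δ, hδ0, K / (1 - θ), f, ?_, fun t ht => ?_, fun t ht => hf t (memle t ht)⟩
  -- Complex scalars matter here: a uniform limit of holomorphic maps is holomorphic.
  · have hu : TendstoUniformlyOn (fun n => curveApprox G p v l n) f atTop (Metric.ball 0 δ) := by
      rw [Metric.tendstoUniformlyOn_iff]
      intro ε hε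
      have h0 : Tendsto (fun n : ℕ => K * δ ^ 2 * θ ^ n / (1 - θ)) atTop (𝓝 0) := by
        simpa using ((tendsto_pow_atTop_nhds_zero_of_lt_one hθ0 hθ1).const_mul
          (K * δ ^ 2)).div_const (1 - θ)
      filter_upwards [h0.eventually_lt_const hε] with n hn t ht
      have ht' := memle t ht
      rw [dist_comm]
      refine (dist_le_of_le_geometric_of_tendsto _ _ hθ1 (step t ht') (hf t ht') n).trans_lt
        (lt_of_le_of_lt ?_ hn)
      have : 0 < 1 - θ := by linarith
      gcongr
    exact hu.tendstoLocallyUniformlyOn.differentiableOn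
      (Eventually.of_forall fun n => (differentiable_curveApprox hG p v l n).differentiableOn)
      Metric.isOpen_ball
  · have ht' := memle t ht
    have := dist_le_of_le_geometric_of_tendsto₀ _ _ hθ1 (step t ht') (hf t ht')
    rw [dist_comm, dist_eq_norm] at this
    have h0 : curveApprox G p v l 0 t = p + t • v := by simp [curveApprox]
    rw [h0] at this
    calc _ ≤ _ := this
      _ = _ := by ring

/-- The global unstable curve of `G` at `p`, as the pointwise limit of `curveApprox`. -/
lemma exists_entire_curve [CompleteSpace E] {G : E → E} (hG : Differentiable ℂ G)
    {p v : E} {l μ K ρ d : ℝ} (hl : 1 < l) (hμ0 : 0 ≤ μ) (hμ : μ < l ^ 2) (hK0 : 0 ≤ K)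
    (hρ : 0 < ρ) (hd : 0 < d)
    (hLip : ∀ z w, ‖z - p‖ ≤ ρ → ‖w - p‖ ≤ ρ → ‖G z - G w‖ ≤ μ * ‖z - w‖)
    (hK : ∀ t : ℂ, ‖t‖ ≤ d → ‖G (p + t • v) - (p + ((l : ℂ) * t) • v)‖ ≤ K * ‖t‖ ^ 2) :
    ∃ f : ℂ → E, Differentiable ℂ f ∧ HasDerivAt f v 0 ∧
      ∀ t, Tendsto (fun n => curveApprox G p v l n t) atTop (𝓝 (f t)) := by
  obtain ⟨δ, hδ, C, g, hgd, hgC, hgl⟩ := exists_local_curve hG hl hμ0 hμ hK0 hρ hd hLip hK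
  have hl0 : 0 < l := by linarith
  -- Any `k` that brings `t / l^k` into the ball gives the same limit, so one `k` can be used on a
  -- whole neighbourhood of `t`.
  have key : ∀ (k : ℕ) (t : ℂ), t / (l : ℂ) ^ k ∈ Metric.ball (0 : ℂ) δ →
      Tendsto (fun n => curveApprox G p v l n t) atTop (𝓝 (G^[k] (g (t / (l : ℂ) ^ k)))) := by
    intro k t ht
    rw [← tendsto_add_atTop_iff_nat k]
    simp only [curveApprox_add]
    exact ((hG.continuous.iterate k).tendsto _).comp (hgl _ ht)
  have hex : ∀ t : ℂ, ∃ k : ℕ, t / (l : ℂ) ^ k ∈ Metric.ball (0 : ℂ) δ := by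
    intro t
    have h0 : Tendsto (fun k : ℕ => ‖t‖ * (l⁻¹) ^ k) atTop (𝓝 0) := by
      simpa using (tendsto_pow_atTop_nhds_zero_of_lt_one (inv_nonneg.2 hl0.le)
        (inv_lt_one_of_one_lt₀ hl)).const_mul ‖t‖
    obtain ⟨k, hk⟩ := (h0.eventually_lt_const hδ).exists
    refine ⟨k, ?_⟩
    rw [mem_ball_zero_iff, norm_div, norm_pow, Complex.norm_real, Real.norm_eq_abs,
      abs_of_pos hl0, div_eq_mul_inv, ← inv_pow]
    exact hk
  choose k hk using hex
  refine ⟨fun t => G^[k t] (g (t / (l : ℂ) ^ k t)), ?_, ?_, fun t => key _ t (hk t)⟩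
  · intro t
    have hopen : ∀ᶠ s in 𝓝 t, s / (l : ℂ) ^ k t ∈ Metric.ball (0 : ℂ) δ :=
      (continuous_id.div_const _).continuousAt.eventually_mem (Metric.isOpen_ball.mem_nhds (hk t))
    have heq : (fun t => G^[k t] (g (t / (l : ℂ) ^ k t)))
        =ᶠ[𝓝 t] fun s => G^[k t] (g (s / (l : ℂ) ^ k t)) := by
      filter_upwards [hopen] with s hs
      exact tendsto_nhds_unique (key _ s (hk s)) (key _ s hs)
    refine DifferentiableAt.congr_of_eventuallyEq ?_ heq
    have h1 : DifferentiableAt ℂ g (t / (l : ℂ) ^ k t) :=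
      hgd.differentiableAt (Metric.isOpen_ball.mem_nhds (hk t))
    exact ((hG.iterate (k t)) _).comp t (h1.comp t ((differentiable_id.div_const _) t))
  · have heq : (fun t => G^[k t] (g (t / (l : ℂ) ^ k t))) =ᶠ[𝓝 0] g := by
      filter_upwards [Metric.ball_mem_nhds (0 : ℂ) hδ] with s hs
      exact tendsto_nhds_unique (key _ s (hk s)) (hgl s hs)
    refine HasDerivAt.congr_of_eventuallyEq ?_ heq
    have h0 : g 0 = p := by
      have := hgC 0 (Metric.mem_ball_self hδ)
      simpa [sub_eq_zero] using this
    rw [hasDerivAt_iff_isLittleO, h0]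
    have hO : (fun t : ℂ => g t - p - (t - 0) • v) =O[𝓝 0] fun t : ℂ => ‖t‖ ^ 2 := by
      refine Asymptotics.IsBigO.of_bound C ?_
      filter_upwards [Metric.ball_mem_nhds (0 : ℂ) hδ] with t ht
      have := hgC t ht
      rw [sub_zero, sub_sub, Real.norm_of_nonneg (by positivity)]
      exact this
    refine hO.trans_isLittleO ?_
    simpa using (Asymptotics.isLittleO_norm_pow_id (E' := ℂ) one_lt_two)

end Linearization

/-! ### The unstable curve of the saddle, through complexification -/

section Curve

/-- The extension of `clockMap` to complex phases. -/
noncomputable def complexClockMap (a : ℝ) (z : ℂ × ℂ) : ℂ × ℂ :=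
  (z.1 + 2 * a * Complex.sin z.1 + a * Complex.sin z.2,
   z.2 + a * Complex.sin z.1 + 2 * a * Complex.sin z.2)

lemma differentiable_complexClockMap (a : ℝ) : Differentiable ℂ (complexClockMap a) := by
  unfold complexClockMap; fun_prop

/-- The embedding of the real plane into the complex plane `ℂ × ℂ`. -/
def complexify (z : ℝ × ℝ) : ℂ × ℂ := (z.1, z.2)

lemma semiconj_complexify (a : ℝ) :
    Function.Semiconj complexify (clockMap a) (complexClockMap a) := by
  intro z
  simp [complexify, clockMap, complexClockMap]

/-- The unstable eigenvalue of the saddle. -/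
noncomputable def unstableEigenvalue (a : ℝ) : ℝ := 1 + Real.sqrt 3 * a

lemma sqrt_three_bounds : (17 / 10 : ℝ) < Real.sqrt 3 ∧ Real.sqrt 3 < 2 := by
  constructor
  · rw [Real.lt_sqrt (by norm_num)]; norm_num
  · rw [Real.sqrt_lt' (by norm_num)]; norm_num

lemma one_lt_unstableEigenvalue {a : ℝ} (ha0 : 0 < a) : 1 < unstableEigenvalue a := by
  unfold unstableEigenvalue
  have : 0 < Real.sqrt 3 * a := by positivity
  linarith

lemma complex_sin_strict_bound {ε : ℝ} (hε : 0 < ε) :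
    ∃ ρ > 0, ∀ u w : ℂ, ‖u‖ ≤ ρ → ‖w‖ ≤ ρ →
      ‖Complex.sin u - Complex.sin w - (u - w)‖ ≤ ε * ‖u - w‖ := by
  have h := (Complex.hasStrictDerivAt_sin 0).hasStrictFDerivAt.isLittleO.def hε
  rw [Metric.eventually_nhds_iff] at h
  obtain ⟨r, hr, h⟩ := h
  refine ⟨r / 2, by positivity, fun u w hu hw => ?_⟩
  have := @h (u, w) (by
    rw [Prod.dist_eq]; simp only [dist_zero_right]
    exact max_lt (by linarith) (by linarith))
  simpa using this

lemma complex_sin_sub_self_bound {u : ℂ} (hu : ‖u‖ ≤ 1) : ‖Complex.sin u - u‖ ≤ ‖u‖ ^ 2 := by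
  have h1 := Complex.norm_exp_sub_one_sub_id_le (x := u * Complex.I) (by simpa using hu)
  have h2 := Complex.norm_exp_sub_one_sub_id_le (x := -u * Complex.I) (by simpa using hu)
  have h : Complex.sin u - u = ((Complex.exp (-u * Complex.I) - 1 - -u * Complex.I)
      - (Complex.exp (u * Complex.I) - 1 - u * Complex.I)) * (Complex.I / 2) := by
    rw [Complex.sin]
    linear_combination -u * Complex.I_mul_I
  rw [h, norm_mul]
  have h3 := norm_sub_le (Complex.exp (-u * Complex.I) - 1 - -u * Complex.I)
    (Complex.exp (u * Complex.I) - 1 - u * Complex.I)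
  have h4 : ‖Complex.I / 2‖ = 1 / 2 := by simp
  simp only [norm_mul, norm_neg, Complex.norm_I, mul_one] at h1 h2
  rw [h4]
  linarith

lemma complex_sin_eq_neg_sin_sub_pi (x : ℂ) :
    Complex.sin x = -Complex.sin (x - (Real.pi : ℂ)) := by
  rw [Complex.sin_sub_pi, neg_neg]

/-- Near the saddle the complex clock map is Lipschitz with a constant below the square of the
unstable eigenvalue. -/
lemma complexClockMap_lipschitz {a : ℝ} (ha0 : 0 < a) (ha : a < 1 / 6) :
    ∃ ρ > 0, ∀ z w : ℂ × ℂ, ‖z - ((Real.pi : ℂ), 0)‖ ≤ ρ → ‖w - ((Real.pi : ℂ), 0)‖ ≤ ρ →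
      ‖complexClockMap a z - complexClockMap a w‖ ≤ (1 + 27 / 8 * a) * ‖z - w‖ := by
  obtain ⟨ρ, hρ, h⟩ := complex_sin_strict_bound (ε := 1 / 8) (by norm_num)
  refine ⟨ρ, hρ, fun z w hz hw => ?_⟩
  obtain ⟨x, y⟩ := z
  obtain ⟨x', y'⟩ := w
  rw [Prod.mk_sub_mk, Prod.norm_mk, max_le_iff] at hz hw
  simp only [sub_zero] at hz hw
  have e1 := h _ _ hz.1 hw.1
  have e2 := h _ _ hz.2 hw.2
  set M := ‖(x, y) - (x', y')‖ with hM
  have d1 : ‖x - x'‖ ≤ M := norm_fst_le ((x, y) - (x', y'))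
  have d2 : ‖y - y'‖ ≤ M := norm_snd_le ((x, y) - (x', y'))
  have hM0 : 0 ≤ M := norm_nonneg _
  set E1 := Complex.sin (x - Real.pi) - Complex.sin (x' - Real.pi)
    - (x - Real.pi - (x' - Real.pi)) with hE1
  set E2 := Complex.sin y - Complex.sin y' - (y - y') with hE2
  have e1' : ‖E1‖ ≤ 1 / 8 * M := e1.trans (by
    rw [sub_sub_sub_cancel_right]; linarith)
  have e2' : ‖E2‖ ≤ 1 / 8 * M := e2.trans (by linarith)
  have c1 : (complexClockMap a (x, y) - complexClockMap a (x', y')).1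
      = ((1 - 2 * a : ℝ) : ℂ) * (x - x') + (a : ℂ) * (y - y') - ((2 * a : ℝ) : ℂ) * E1
        + (a : ℂ) * E2 := by
    simp only [complexClockMap, Prod.mk_sub_mk, hE1, hE2]
    rw [complex_sin_eq_neg_sin_sub_pi x, complex_sin_eq_neg_sin_sub_pi x']
    push_cast; ring
  have c2 : (complexClockMap a (x, y) - complexClockMap a (x', y')).2
      = ((1 + 2 * a : ℝ) : ℂ) * (y - y') - (a : ℂ) * (x - x') - (a : ℂ) * E1
        + ((2 * a : ℝ) : ℂ) * E2 := by
    simp only [complexClockMap, Prod.mk_sub_mk, hE1, hE2]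
    rw [complex_sin_eq_neg_sin_sub_pi x, complex_sin_eq_neg_sin_sub_pi x']
    push_cast; ring
  have nr : ∀ (r : ℝ) (u : ℂ) (B : ℝ), 0 ≤ r → ‖u‖ ≤ B → ‖(r : ℂ) * u‖ ≤ r * B := by
    intro r u B hr hu
    rw [norm_mul, Complex.norm_real, Real.norm_of_nonneg hr]; gcongr
  have tri : ∀ A B C D : ℂ, ‖A + B - C + D‖ ≤ ‖A‖ + ‖B‖ + ‖C‖ + ‖D‖ := fun A B C D =>
    (norm_add_le _ _).trans (add_le_add_left ((norm_sub_le _ _).trans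
      (add_le_add_left (norm_add_le _ _) _)) _)
  have tri' : ∀ A B C D : ℂ, ‖A - B - C + D‖ ≤ ‖A‖ + ‖B‖ + ‖C‖ + ‖D‖ := fun A B C D =>
    (norm_add_le _ _).trans (add_le_add_left ((norm_sub_le _ _).trans
      (add_le_add_left (norm_sub_le _ _) _)) _)
  have haM : 0 ≤ a * M := by positivity
  rw [← Prod.mk.eta (p := complexClockMap a (x, y) - complexClockMap a (x', y')), Prod.norm_mk,
    c1, c2]
  refine max_le ((tri _ _ _ _).trans ?_) ((tri' _ _ _ _).trans ?_)
  · have := nr (1 - 2 * a) _ _ (by linarith) d1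
    have := nr a _ _ ha0.le d2
    have := nr (2 * a) _ _ (by linarith) e1'
    have := nr a _ _ ha0.le e2'
    nlinarith
  -- The second row is the critical one: `1 + 2a + a + a/8 + 2a/8 = 1 + 27a/8`.
  · have := nr (1 + 2 * a) _ _ (by linarith) d2
    have := nr a _ _ ha0.le d1
    have := nr a _ _ ha0.le e1'
    have := nr (2 * a) _ _ (by linarith) e2'
    nlinarith

/-- The linear parts cancel by the eigenvector equation. Only the remainders of the two sines
survive, with total weight `3a < 1`. -/
lemma complexClockMap_along_eigenvector {a : ℝ} (ha0 : 0 < a) (ha : a < 1 / 6) (t : ℂ)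
    (ht : ‖t‖ ≤ 1) :
    ‖complexClockMap a (((Real.pi : ℂ), 0) + t • (((2 - Real.sqrt 3 : ℝ) : ℂ), (1 : ℂ)))
      - (((Real.pi : ℂ), 0)
        + ((unstableEigenvalue a : ℂ) * t) • (((2 - Real.sqrt 3 : ℝ) : ℂ), (1 : ℂ)))‖
      ≤ 1 * ‖t‖ ^ 2 := by
  obtain ⟨s1, s2⟩ := sqrt_three_bounds
  have sq : ((Real.sqrt 3 : ℝ) : ℂ) ^ 2 = 3 := by
    rw [← Complex.ofReal_pow, Real.sq_sqrt (by norm_num)]; simp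
  set c : ℂ := ((2 - Real.sqrt 3 : ℝ) : ℂ) with hc
  have hcn : ‖t * c‖ ≤ ‖t‖ := by
    rw [norm_mul, hc, Complex.norm_real, Real.norm_of_nonneg (by linarith)]
    exact mul_le_of_le_one_right (norm_nonneg _) (by linarith)
  have e1 := complex_sin_sub_self_bound (hcn.trans ht)
  have e1' : ‖Complex.sin (t * c) - t * c‖ ≤ ‖t‖ ^ 2 := e1.trans (by gcongr)
  have e2 := complex_sin_sub_self_bound ht
  have hs : Complex.sin ((Real.pi : ℂ) + t * c) = -Complex.sin (t * c) := by
    rw [complex_sin_eq_neg_sin_sub_pi]; simp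
  have c1 : complexClockMap a (((Real.pi : ℂ), 0) + t • (c, (1 : ℂ)))
      - (((Real.pi : ℂ), 0) + ((unstableEigenvalue a : ℂ) * t) • (c, (1 : ℂ)))
      = ((a : ℂ) * (Complex.sin t - t) - ((2 * a : ℝ) : ℂ) * (Complex.sin (t * c) - t * c),
        ((2 * a : ℝ) : ℂ) * (Complex.sin t - t) - (a : ℂ) * (Complex.sin (t * c) - t * c)) := by
    simp only [complexClockMap, Prod.smul_mk, Prod.mk_add_mk, Prod.mk_sub_mk, smul_eq_mul, mul_one,
      zero_add, hs, unstableEigenvalue]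
    ext
    · simp only [hc]; push_cast
      linear_combination (a : ℂ) * t * sq
    · simp only [hc]; push_cast; ring
  rw [c1, Prod.norm_mk, one_mul]
  have nr : ∀ (r : ℝ) (u : ℂ) (B : ℝ), 0 ≤ r → ‖u‖ ≤ B → ‖(r : ℂ) * u‖ ≤ r * B := by
    intro r u B hr hu
    rw [norm_mul, Complex.norm_real, Real.norm_of_nonneg hr]; gcongr
  have ht2 : 0 ≤ ‖t‖ ^ 2 := by positivity
  refine max_le ((norm_sub_le _ _).trans ?_) ((norm_sub_le _ _).trans ?_)
  · have := nr a _ _ ha0.le e2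
    have := nr (2 * a) _ _ (by linarith) e1'
    nlinarith
  · have := nr (2 * a) _ _ (by linarith) e2
    have := nr a _ _ ha0.le e1'
    nlinarith

/-- The unstable curve of the saddle `(π, 0)`, as a pointwise limit. -/
lemma exists_smooth_limit_curve {a : ℝ} (ha0 : 0 < a) (ha : a < 1 / 6) :
    ∃ σ : ℝ → ℝ × ℝ, ContDiff ℝ ∞ σ ∧ HasDerivAt σ (2 - Real.sqrt 3, 1) 0 ∧
      ∀ t, Tendsto (fun n : ℕ => (clockMap a)^[n]
        ((Real.pi, 0) + (t / unstableEigenvalue a ^ n) • (2 - Real.sqrt 3, (1 : ℝ))))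
        atTop (𝓝 (σ t)) := by
  obtain ⟨s1, s2⟩ := sqrt_three_bounds
  have s3 : Real.sqrt 3 ^ 2 = 3 := Real.sq_sqrt (by norm_num)
  obtain ⟨ρ, hρ, hLip⟩ := complexClockMap_lipschitz ha0 ha
  obtain ⟨f, hfd, hf0, hfl⟩ := exists_entire_curve (differentiable_complexClockMap a)
    (p := ((Real.pi : ℂ), 0)) (v := (((2 - Real.sqrt 3 : ℝ) : ℂ), (1 : ℂ)))
    (one_lt_unstableEigenvalue ha0) (μ := 1 + 27 / 8 * a) (by positivity)
    (by
      -- `1 + 27a/8 < (1 + √3 a)^2`, since `2√3 > 3.4 > 27/8`.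
      unfold unstableEigenvalue
      nlinarith [mul_pos ha0 (sub_pos.2 s1), sq_nonneg (Real.sqrt 3 * a)]) zero_le_one hρ one_pos hLip
    (complexClockMap_along_eigenvector ha0 ha)
  let R : ℂ × ℂ →L[ℝ] ℝ × ℝ := Complex.reCLM.prodMap Complex.reCLM
  have hR : ∀ z, R (complexify z) = z := fun z => by simp [R, complexify]
  refine ⟨fun t => R (f t), ?_, ?_, fun t => ?_⟩
  · have h1 : ContDiff ℝ ∞ f := (hfd.contDiff (n := ∞)).restrict_scalars ℝ
    exact R.contDiff.comp (h1.comp Complex.ofRealCLM.contDiff)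
  · have h1 : HasDerivAt (fun t : ℝ => f t) (((2 - Real.sqrt 3 : ℝ) : ℂ), (1 : ℂ)) 0 := by
      have : HasDerivAt f (((2 - Real.sqrt 3 : ℝ) : ℂ), (1 : ℂ)) ((0 : ℝ) : ℂ) := by simpa using hf0
      simpa [Function.comp_def] using (this.hasFDerivAt.restrictScalars ℝ).comp_hasDerivAt (0 : ℝ)
        Complex.ofRealCLM.hasDerivAt
    have h2 := R.hasFDerivAt.comp_hasDerivAt (0 : ℝ) h1
    have h3 : R (((2 - Real.sqrt 3 : ℝ) : ℂ), (1 : ℂ)) = (2 - Real.sqrt 3, 1) := by simp [R]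
    rw [h3] at h2
    exact h2
  · have h1 := (R.continuous.tendsto _).comp (hfl (t : ℂ))
    refine h1.congr fun n => ?_
    have h2 : curveApprox (complexClockMap a) ((Real.pi : ℂ), 0)
        (((2 - Real.sqrt 3 : ℝ) : ℂ), (1 : ℂ)) (unstableEigenvalue a) n t
        = complexify ((clockMap a)^[n]
        ((Real.pi, 0) + (t / unstableEigenvalue a ^ n) • (2 - Real.sqrt 3, (1 : ℝ)))) := by
      rw [((semiconj_complexify a).iterate_right n).eq, curveApprox]
      simp [complexify]
    simp only [Function.comp_apply, h2, hR]

lemma continuous_clockMap (a : ℝ) : Continuous (clockMap a) := by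
  unfold clockMap; fun_prop

/-- `clockMap` commutes with the point reflection in the saddle. -/
lemma clockMap_reflect (a : ℝ) (z : ℝ × ℝ) :
    clockMap a (2 • (Real.pi, (0 : ℝ)) - z) = 2 • (Real.pi, (0 : ℝ)) - clockMap a z := by
  have h : Real.sin (2 * Real.pi - z.1) = -Real.sin z.1 := Real.sin_two_pi_sub _
  ext <;> simp [clockMap, h] <;> ring

/-- Both identities pass to the limit: `F` sends the `n`-th approximation at `t` to the `(n+1)`-st
at `l t`, and the reflection in the saddle commutes with `F` while reversing `t`. -/
lemma exists_unstable_curve {a : ℝ} (ha0 : 0 < a) (ha : a < 1 / 6) :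
    ∃ σ : ℝ → ℝ × ℝ, ContDiff ℝ ∞ σ ∧ HasDerivAt σ (2 - Real.sqrt 3, 1) 0 ∧ σ 0 = (Real.pi, 0) ∧
      (∀ t, clockMap a (σ t) = σ (unstableEigenvalue a * t)) ∧
      ∀ t, σ (-t) = 2 • (Real.pi, (0 : ℝ)) - σ t := by
  obtain ⟨σ, hσ, h0, hlim⟩ := exists_smooth_limit_curve ha0 ha
  have hl := (one_lt_unstableEigenvalue ha0)
  have hl0 : unstableEigenvalue a ≠ 0 := by positivity
  refine ⟨σ, hσ, h0, ?_, fun t => ?_, fun t => ?_⟩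
  · have hfix : ∀ n : ℕ, (clockMap a)^[n] (Real.pi, 0) = (Real.pi, 0) := fun n =>
      Function.iterate_fixed (by simp [clockMap]) n
    refine tendsto_nhds_unique (hlim 0) ?_
    have : ∀ n : ℕ, (Real.pi, (0 : ℝ)) + ((0 : ℝ) / unstableEigenvalue a ^ n) •
        (2 - Real.sqrt 3, (1 : ℝ)) = (Real.pi, 0) := fun n => by simp
    simp only [this, hfix]
    exact tendsto_const_nhds
  · have h1 := ((continuous_clockMap a).tendsto _).comp (hlim t)
    have h2 := (tendsto_add_atTop_iff_nat 1).2 (hlim (unstableEigenvalue a * t))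
    refine tendsto_nhds_unique h1 (h2.congr fun n => ?_)
    rw [Function.iterate_succ_apply', Function.comp_apply, pow_succ', mul_div_mul_left _ _ hl0]
  · have h1 := (hlim t).const_sub (2 • (Real.pi, (0 : ℝ)))
    refine tendsto_nhds_unique (hlim (-t)) (h1.congr fun n => ?_)
    have hs : Function.Semiconj (fun z : ℝ × ℝ => 2 • (Real.pi, (0 : ℝ)) - z)
      (clockMap a) (clockMap a) := fun z => (clockMap_reflect a z).symm
    rw [(hs.iterate_right n).eq]
    congr 1
    rw [neg_div, neg_smul, two_smul]
    abel

end Curve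

/-! ### The curve fills the unstable set -/

section UnstableSet

lemma real_sin_strict_bound {ε : ℝ} (hε : 0 < ε) :
    ∃ ρ > 0, ∀ u w : ℝ, |u| ≤ ρ → |w| ≤ ρ → |Real.sin u - Real.sin w - (u - w)| ≤ ε * |u - w| := by
  obtain ⟨ρ, hρ, h⟩ := complex_sin_strict_bound hε
  refine ⟨ρ, hρ, fun u w hu hw => ?_⟩
  have := h u w (by simpa using hu) (by simpa using hw)
  rw [← Complex.ofReal_sin, ← Complex.ofReal_sin, ← Complex.ofReal_sub, ← Complex.ofReal_sub,
    ← Complex.ofReal_sub, Complex.norm_real, Complex.norm_real] at this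
  exact this

/-- The coordinate along the unstable direction of the saddle. -/
noncomputable def unstableCoord (u : ℝ × ℝ) : ℝ := (2 + Real.sqrt 3) * u.2 - u.1

/-- The coordinate along the stable direction of the saddle. -/
noncomputable def stableCoord (u : ℝ × ℝ) : ℝ := (2 - Real.sqrt 3) * u.2 - u.1

lemma abs_coord_le (u : ℝ × ℝ) {m : ℝ} (h1 : |unstableCoord u| ≤ m) (h2 : |stableCoord u| ≤ m) :
    |u.1| ≤ 2 * m ∧ |u.2| ≤ m := by
  obtain ⟨s1, s2⟩ := sqrt_three_bounds
  unfold unstableCoord at h1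
  unfold stableCoord at h2
  rw [abs_le] at h1 h2
  have hy : |u.2| ≤ m := by
    rw [abs_le]; constructor <;> nlinarith
  have hm : 0 ≤ m := (abs_nonneg _).trans hy
  have := abs_le.1 hy
  refine ⟨?_, hy⟩
  rw [abs_le]; constructor <;> nlinarith

lemma abs_add_two_mul_le {A B e f ε m : ℝ} (hA : |A| ≤ 2) (hB : |B| ≤ 7)
    (he : |e| ≤ ε * m) (hf : |f| ≤ ε * m) : |A * e + B * f| ≤ 9 * (ε * m) := by
  have h1 : |A * e| ≤ 2 * (ε * m) := by
    rw [abs_mul]; exact mul_le_mul hA he (abs_nonneg _) (by norm_num)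
  have h2 : |B * f| ≤ 7 * (ε * m) := by
    rw [abs_mul]; exact mul_le_mul hB hf (abs_nonneg _) (by norm_num)
  have := abs_add_le (A * e) (B * f)
  linarith

/-- The two coordinates are left eigenvectors of the derivative at the saddle, so only sine
remainders are left. Each is at most `(1/100) * 2m`, and coefficients summing to at most `9` give
`0.18 a m`. -/
lemma clockMap_coord_estimate {a : ℝ} (ha0 : 0 < a) :
    ∃ ρ > 0, ∀ z w : ℝ × ℝ, ‖z - (Real.pi, 0)‖ ≤ ρ → ‖w - (Real.pi, 0)‖ ≤ ρ →
      ∀ m, |unstableCoord (z - w)| ≤ m → |stableCoord (z - w)| ≤ m →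
      |unstableCoord (clockMap a z - clockMap a w)
        - (1 + Real.sqrt 3 * a) * unstableCoord (z - w)| ≤ 1 / 5 * a * m ∧
      |stableCoord (clockMap a z - clockMap a w)
        - (1 - Real.sqrt 3 * a) * stableCoord (z - w)| ≤ 1 / 5 * a * m := by
  obtain ⟨s1, s2⟩ := sqrt_three_bounds
  have s3 : Real.sqrt 3 ^ 2 = 3 := Real.sq_sqrt (by norm_num)
  obtain ⟨ρ, hρ, h⟩ := real_sin_strict_bound (ε := 1 / 100) (by norm_num)
  refine ⟨ρ, hρ, fun z w hz hw m h1 h2 => ?_⟩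
  obtain ⟨b1, b2⟩ := abs_coord_le _ h1 h2
  have hm : 0 ≤ m := (abs_nonneg _).trans h1
  obtain ⟨x, y⟩ := z
  obtain ⟨x', y'⟩ := w
  rw [Prod.mk_sub_mk, Prod.norm_mk, max_le_iff] at hz hw
  simp only [sub_zero, Real.norm_eq_abs] at hz hw
  have e1 := h _ _ hz.1 hw.1
  have e2 := h _ _ hz.2 hw.2
  rw [sub_sub_sub_cancel_right, Real.sin_sub_pi, Real.sin_sub_pi] at e1
  simp only [Prod.mk_sub_mk] at b1 b2 ⊢
  set E1 := -Real.sin x - -Real.sin x' - (x - x') with hE1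
  set E2 := Real.sin y - Real.sin y' - (y - y') with hE2
  have e1' : |E1| ≤ 1 / 100 * (2 * m) := e1.trans (by linarith)
  have e2' : |E2| ≤ 1 / 100 * (2 * m) := e2.trans (by linarith)
  have c1 : unstableCoord (clockMap a (x, y) - clockMap a (x', y'))
      - (1 + Real.sqrt 3 * a) * unstableCoord (x - x', y - y')
      = a * ((-Real.sqrt 3) * E1 + (3 + 2 * Real.sqrt 3) * E2) := by
    simp only [clockMap, unstableCoord, Prod.fst_sub, Prod.snd_sub, hE1, hE2]
    linear_combination (-a * (y - y')) * s3
  have c2 : stableCoord (clockMap a (x, y) - clockMap a (x', y'))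
      - (1 - Real.sqrt 3 * a) * stableCoord (x - x', y - y')
      = a * (Real.sqrt 3 * E1 + (3 - 2 * Real.sqrt 3) * E2) := by
    simp only [clockMap, stableCoord, Prod.fst_sub, Prod.snd_sub, hE1, hE2]
    linear_combination (-a * (y - y')) * s3
  rw [c1, c2, abs_mul, abs_mul, abs_of_pos ha0]
  have k1 := abs_add_two_mul_le (A := -Real.sqrt 3) (B := 3 + 2 * Real.sqrt 3)
    (by rw [abs_le]; constructor <;> linarith) (by rw [abs_le]; constructor <;> linarith) e1' e2'
  have k2 := abs_add_two_mul_le (A := Real.sqrt 3) (B := 3 - 2 * Real.sqrt 3)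
    (by rw [abs_le]; constructor <;> linarith) (by rw [abs_le]; constructor <;> linarith) e1' e2'
  have ham : 0 ≤ a * m := by positivity
  constructor
  · have := mul_le_mul_of_nonneg_left k1 ha0.le
    linarith
  · have := mul_le_mul_of_nonneg_left k2 ha0.le
    linarith

/-- The stable cone at the saddle is invariant under backward iteration, and is expanded by it. -/
lemma stable_cone_backward {a : ℝ} (ha0 : 0 < a) (ha : a < 1 / 6) :
    ∃ ρ > 0, ∀ z w : ℝ × ℝ, ‖z - (Real.pi, 0)‖ ≤ ρ → ‖w - (Real.pi, 0)‖ ≤ ρ →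
      |unstableCoord (clockMap a z - clockMap a w)| ≤ |stableCoord (clockMap a z - clockMap a w)| →
      |unstableCoord (z - w)| ≤ |stableCoord (z - w)| ∧
        |stableCoord (clockMap a z - clockMap a w)| ≤ (1 - a) * |stableCoord (z - w)| := by
  obtain ⟨s1, s2⟩ := sqrt_three_bounds
  obtain ⟨ρ, hρ, h⟩ := clockMap_coord_estimate ha0
  refine ⟨ρ, hρ, fun z w hz hw hc => ?_⟩
  have h := h z w hz hw
  set X := unstableCoord (z - w)
  set Y := stableCoord (z - w)
  set X' := unstableCoord (clockMap a z - clockMap a w)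
  set Y' := stableCoord (clockMap a z - clockMap a w)
  have hs : 0 < 1 - Real.sqrt 3 * a := by nlinarith
  have lowX : ∀ m, |X| ≤ m → |Y| ≤ m → (1 + Real.sqrt 3 * a) * |X| - 1 / 5 * a * m ≤ |X'| := by
    intro m h1 h2
    have h3 := (h m h1 h2).1
    have h4 := abs_sub_abs_le_abs_sub ((1 + Real.sqrt 3 * a) * X) X'
    rw [abs_mul, abs_of_pos (by positivity : 0 < 1 + Real.sqrt 3 * a), abs_sub_comm] at h4
    linarith
  have upY : ∀ m, |X| ≤ m → |Y| ≤ m → |Y'| ≤ (1 - Real.sqrt 3 * a) * |Y| + 1 / 5 * a * m := by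
    intro m h1 h2
    have h3 := (h m h1 h2).2
    have h4 := abs_sub_abs_le_abs_sub Y' ((1 - Real.sqrt 3 * a) * Y)
    rw [abs_mul, abs_of_pos hs] at h4
    linarith
  -- Otherwise `|X'| ≥ (1 + √3 a - a/5)|X| > (1 - √3 a + a/5)|X| ≥ |Y'|`, against the cone condition
  -- on the images.
  have hXY : |X| ≤ |Y| := by
    by_contra! hlt
    have hX : 0 < |X| := (abs_nonneg _).trans_lt hlt
    have l1 := lowX _ le_rfl hlt.le
    have l2 := upY _ le_rfl hlt.le
    have l3 : (1 - Real.sqrt 3 * a) * |Y| ≤ (1 - Real.sqrt 3 * a) * |X| := by gcongr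
    have l4 : 0 < a * |X| := by positivity
    nlinarith
  refine ⟨hXY, ?_⟩
  have l2 := upY _ hXY le_rfl
  have l4 : 0 ≤ a * |Y| := by positivity
  nlinarith

/-- The nonzero derivative makes the unstable coordinate a local parameter of the curve, which
serves both surjectivity onto the unstable set and injectivity. -/
lemma hasStrictDerivAt_unstableCoord_curve {σ : ℝ → ℝ × ℝ} (hσ : ContDiff ℝ ∞ σ)
    (h0 : HasDerivAt σ (2 - Real.sqrt 3, 1) 0) :
    HasStrictDerivAt (fun t => unstableCoord (σ t)) (2 * Real.sqrt 3) 0 := by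
  have h : ContDiff ℝ ∞ fun t => unstableCoord (σ t) := by
    unfold unstableCoord; fun_prop
  have h1 := h.contDiffAt.hasStrictDerivAt (x := 0) (by simp)
  have h2 : HasDerivAt (fun t => unstableCoord (σ t)) (2 * Real.sqrt 3) 0 := by
    unfold unstableCoord
    have hf := (ContinuousLinearMap.fst ℝ ℝ ℝ).hasFDerivAt.comp_hasDerivAt (0 : ℝ) h0
    have hs := (ContinuousLinearMap.snd ℝ ℝ ℝ).hasFDerivAt.comp_hasDerivAt (0 : ℝ) h0
    have := (hs.const_mul (2 + Real.sqrt 3)).sub hf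
    refine this.congr_deriv ?_
    simp; ring
  rwa [h2.deriv] at h1

lemma tendsto_div_pow_zero {l : ℝ} (hl : 1 < l) (t : ℝ) :
    Tendsto (fun n : ℕ => t / l ^ n) atTop (𝓝 0) := by
  have := (tendsto_pow_atTop_nhds_zero_of_lt_one (inv_nonneg.2 (by linarith : (0 : ℝ) ≤ l))
    (inv_lt_one_of_one_lt₀ hl)).const_mul t
  simpa [div_eq_mul_inv] using this

lemma mul_div_pow_succ {l : ℝ} (hl : 1 < l) (t : ℝ) (n : ℕ) : l * (t / l ^ (n + 1)) = t / l ^ n := by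
  rw [pow_succ', ← mul_div_assoc, mul_div_mul_left _ _ (by positivity)]

lemma iterate_curve {F : ℝ × ℝ → ℝ × ℝ} {σ : ℝ → ℝ × ℝ} {l : ℝ}
    (hF : ∀ t, F (σ t) = σ (l * t)) (n : ℕ) (t : ℝ) : F^[n] (σ t) = σ (l ^ n * t) := by
  induction n with
  | zero => simp
  | succ n ih => rw [Function.iterate_succ_apply', ih, hF]; ring_nf

lemma iterate_backward {F : ℝ × ℝ → ℝ × ℝ} {X : ℕ → ℝ × ℝ} (hX : ∀ n, F (X (n + 1)) = X n)
    (n : ℕ) : F^[n] (X n) = X 0 := by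
  induction n with
  | zero => rfl
  | succ n ih => rw [Function.iterate_succ_apply, hX, ih]

lemma range_subset_unstableSet {F : ℝ × ℝ → ℝ × ℝ} {σ : ℝ → ℝ × ℝ} {l : ℝ} (hl : 1 < l)
    (hc : Continuous σ) (hF : ∀ t, F (σ t) = σ (l * t)) :
    Set.range σ ⊆ unstableSet F (σ 0) := by
  rintro _ ⟨t, rfl⟩
  refine ⟨fun n => σ (t / l ^ n), by simp, fun n => ?_, ?_⟩
  · rw [hF, mul_div_pow_succ hl]
  · exact (hc.tendsto 0).comp (tendsto_div_pow_zero hl t)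

lemma eq_zero_of_geometric_growth {y : ℕ → ℝ} {c B : ℝ} (hc0 : 0 ≤ c) (hc : c < 1)
    (h : ∀ n, |y n| ≤ c * |y (n + 1)|) (hB : ∀ n, |y n| ≤ B) : y 0 = 0 := by
  have h1 : ∀ n, |y 0| ≤ c ^ n * |y n| := by
    intro n
    induction n with
    | zero => simp
    | succ n ih =>
      calc |y 0| ≤ c ^ n * |y n| := ih
        _ ≤ c ^ n * (c * |y (n + 1)|) := by gcongr; exact h n
        _ = _ := by ring
  have h2 : Tendsto (fun n : ℕ => c ^ n * B) atTop (𝓝 0) := by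
    simpa using (tendsto_pow_atTop_nhds_zero_of_lt_one hc0 hc).mul_const B
  have h3 : |y 0| ≤ 0 := ge_of_tendsto' h2 fun n => (h1 n).trans (by gcongr; exact hB n)
  exact abs_nonpos_iff.1 h3

/-- Late in the backward orbit `X`, choose the curve point with the same unstable coordinate. The
difference lies in the stable cone, stays there under backward iteration and grows by at least `1 /
(1 - a)` per step, yet both orbits remain near the saddle; so it is zero. -/
lemma unstableSet_subset_range {a : ℝ} (ha0 : 0 < a) (ha : a < 1 / 6) {σ : ℝ → ℝ × ℝ}
    (hσ : ContDiff ℝ ∞ σ) (h0 : HasDerivAt σ (2 - Real.sqrt 3, 1) 0) (hp : σ 0 = (Real.pi, 0))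
    (hF : ∀ t, clockMap a (σ t) = σ (unstableEigenvalue a * t)) :
    unstableSet (clockMap a) (Real.pi, 0) ⊆ Set.range σ := by
  rintro z ⟨X, rfl, hX, hlim⟩
  obtain ⟨s1, s2⟩ := sqrt_three_bounds
  have hl := one_lt_unstableEigenvalue ha0
  obtain ⟨ρ, hρ, hcone⟩ := stable_cone_backward ha0 ha
  obtain ⟨δ, hδ, hball⟩ : ∃ δ > 0, ∀ t, |t| < δ → ‖σ t - (Real.pi, 0)‖ ≤ ρ := by
    obtain ⟨δ, hδ, h⟩ := Metric.continuousAt_iff.1 (hσ.continuous.continuousAt (x := 0)) ρ hρ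
    refine ⟨δ, hδ, fun t ht => ?_⟩
    have := h (x := t) (by simpa [Real.dist_eq] using ht)
    rw [dist_eq_norm, hp] at this
    exact this.le
  -- Short arcs of the curve cover a neighbourhood of values of the unstable coordinate, which makes
  -- the matching point available.
  have hmap := (hasStrictDerivAt_unstableCoord_curve hσ h0).map_nhds_eq (by positivity)
  have hU : (fun t => unstableCoord (σ t)) '' Metric.ball 0 δ ∈ 𝓝 (unstableCoord (Real.pi, 0)) := by
    rw [hp] at hmap
    rw [← hmap]
    exact image_mem_map (Metric.ball_mem_nhds 0 hδ)
  have hcont : Continuous unstableCoord := by unfold unstableCoord; fun_prop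
  have ev1 := ((hcont.tendsto _).comp hlim).eventually_mem hU
  have ev2 := hlim.eventually_mem (Metric.closedBall_mem_nhds (Real.pi, (0 : ℝ)) hρ)
  obtain ⟨N, hN⟩ := eventually_atTop.1 (ev1.and ev2)
  obtain ⟨t, ht, hteq⟩ := (hN N le_rfl).1
  have ht : |t| < δ := by simpa [Real.dist_eq] using ht
  set Y : ℕ → ℝ × ℝ := fun k => σ (t / unstableEigenvalue a ^ k) with hY
  have hYs : ∀ k, clockMap a (Y (k + 1)) = Y k := by
    intro k
    simp only [hY, hF, mul_div_pow_succ hl]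
  have hYρ : ∀ k, ‖Y k - (Real.pi, 0)‖ ≤ ρ := by
    intro k
    refine hball _ (lt_of_le_of_lt ?_ ht)
    rw [abs_div]
    refine div_le_self (abs_nonneg _) ?_
    rw [abs_of_pos (by positivity)]
    exact one_le_pow₀ hl.le
  have hXρ : ∀ k, ‖X (N + k) - (Real.pi, 0)‖ ≤ ρ := fun k => by
    have := (hN (N + k) (by omega)).2
    rwa [mem_closedBall_iff_norm] at this
  have hstep : ∀ k, |unstableCoord (X (N + k) - Y k)| ≤ |stableCoord (X (N + k) - Y k)| →
      |unstableCoord (X (N + (k + 1)) - Y (k + 1))| ≤ |stableCoord (X (N + (k + 1)) - Y (k + 1))| ∧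
      |stableCoord (X (N + k) - Y k)| ≤ (1 - a) * |stableCoord (X (N + (k + 1)) - Y (k + 1))| := by
    intro k hk
    have := hcone _ _ (hXρ (k + 1)) (hYρ (k + 1))
    rw [hYs, ← add_assoc, hX] at this
    exact this hk
  have hzero : unstableCoord (X N - Y 0) = 0 := by
    have h1 : unstableCoord (X N - Y 0) = unstableCoord (X N) - unstableCoord (Y 0) := by
      simp [unstableCoord]; ring
    rw [h1, sub_eq_zero]
    simpa [hY] using hteq.symm
  have hall : ∀ k, |unstableCoord (X (N + k) - Y k)| ≤ |stableCoord (X (N + k) - Y k)| := by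
    intro k
    induction k with
    | zero => rw [add_zero, hzero]; simp
    | succ k ih => exact (hstep k ih).1
  have hbound : ∀ k, |stableCoord (X (N + k) - Y k)| ≤ 2 * (2 * ρ) := by
    intro k
    have h1 : ‖X (N + k) - Y k‖ ≤ 2 * ρ := by
      have := norm_sub_le (X (N + k) - (Real.pi, 0)) (Y k - (Real.pi, 0))
      rw [sub_sub_sub_cancel_right] at this
      linarith [hXρ k, hYρ k]
    have h2 := (norm_fst_le (X (N + k) - Y k)).trans h1
    have h3 := (norm_snd_le (X (N + k) - Y k)).trans h1
    rw [Real.norm_eq_abs, abs_le] at h2 h3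
    unfold stableCoord
    rw [abs_le]; constructor <;> nlinarith
  have hst : stableCoord (X (N + 0) - Y 0) = 0 :=
    eq_zero_of_geometric_growth (y := fun k => stableCoord (X (N + k) - Y k)) (c := 1 - a)
      (by linarith) (by linarith) (fun k => (hstep k (hall k)).2) hbound
  have hXN : X N = σ t := by
    have := abs_coord_le (X N - Y 0) (m := 0) (by simp [hzero]) (by
      rw [add_zero] at hst; simp [hst])
    simp only [mul_zero, abs_nonpos_iff, Prod.fst_sub, Prod.snd_sub, sub_eq_zero] at this
    rw [Prod.ext_iff]
    simpa [hY] using this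
  exact ⟨unstableEigenvalue a ^ N * t, by rw [← iterate_curve hF, ← hXN, iterate_backward hX]⟩

end UnstableSet

/-! ### The curve is an injective immersion -/

section Immersion

/-- Adding the inequalities gives `|u| + |v| ≤ 3a (|u| + |v|)` with `3a < 1`. This yields
injectivity of the map and of its derivative. -/
lemma eq_zero_of_dominated {a u v : ℝ} (ha0 : 0 < a) (ha : a < 1 / 6)
    (h1 : |u| ≤ 2 * a * |u| + a * |v|) (h2 : |v| ≤ a * |u| + 2 * a * |v|) : u = 0 ∧ v = 0 := by
  have hu := abs_nonneg u
  have hv := abs_nonneg v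
  have h : |u| + |v| ≤ 0 := by nlinarith
  exact ⟨abs_nonpos_iff.1 (by linarith), abs_nonpos_iff.1 (by linarith)⟩

lemma abs_le_of_add_eq_zero {a u A B p q : ℝ} (ha0 : 0 < a) (h : u + a * A + a * B = 0)
    (hA : |A| ≤ p) (hB : |B| ≤ q) : |u| ≤ a * p + a * q := by
  have : u = -(a * A) + -(a * B) := by linarith
  rw [this]
  refine (abs_add_le _ _).trans ?_
  rw [abs_neg, abs_neg, abs_mul, abs_mul, abs_of_pos ha0]
  gcongr

lemma clockMap_injective {a : ℝ} (ha0 : 0 < a) (ha : a < 1 / 6) :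
    Function.Injective (clockMap a) := by
  rintro ⟨x, y⟩ ⟨x', y'⟩ h
  simp only [clockMap, Prod.mk.injEq] at h
  have b1 := Real.abs_sin_sub_sin_le x x'
  have b2 := Real.abs_sin_sub_sin_le y y'
  have b1' : |2 * (Real.sin x - Real.sin x')| ≤ 2 * |x - x'| := by
    rw [abs_mul, abs_two]; linarith
  have b2' : |2 * (Real.sin y - Real.sin y')| ≤ 2 * |y - y'| := by
    rw [abs_mul, abs_two]; linarith
  have h1 := abs_le_of_add_eq_zero (u := x - x') ha0 (by linarith [h.1]) b1' b2
  have h2 := abs_le_of_add_eq_zero (u := y - y') ha0 (by linarith [h.2]) b1 b2'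
  have := eq_zero_of_dominated ha0 ha (u := x - x') (v := y - y') (by linarith) (by linarith)
  rw [sub_eq_zero, sub_eq_zero] at this
  exact Prod.ext this.1 this.2

lemma curve_injective {a : ℝ} (ha0 : 0 < a) (ha : a < 1 / 6) {σ : ℝ → ℝ × ℝ}
    (hσ : ContDiff ℝ ∞ σ) (h0 : HasDerivAt σ (2 - Real.sqrt 3, 1) 0)
    (hF : ∀ t, clockMap a (σ t) = σ (unstableEigenvalue a * t)) : Function.Injective σ := by
  have hl := one_lt_unstableEigenvalue ha0
  have hs : (0 : ℝ) < 2 * Real.sqrt 3 := by positivity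
  -- The tolerance `√3` is half the derivative, so the coordinate separates parameters near `0`;
  -- coinciding points are pulled back there.
  have hstrict := (hasStrictDerivAt_unstableCoord_curve hσ h0).hasStrictFDerivAt.isLittleO.def
    (c := Real.sqrt 3) (by positivity)
  intro t t' htt
  have hback : ∀ n : ℕ, σ (t / unstableEigenvalue a ^ n) = σ (t' / unstableEigenvalue a ^ n) := by
    intro n
    apply (clockMap_injective ha0 ha).iterate n
    rw [iterate_curve hF, iterate_curve hF, mul_div_cancel₀ _ (by positivity),
      mul_div_cancel₀ _ (by positivity), htt]
  have hpair : Tendsto (fun n : ℕ => (t / unstableEigenvalue a ^ n, t' / unstableEigenvalue a ^ n))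
      atTop (𝓝 ((0 : ℝ), (0 : ℝ))) :=
    (tendsto_div_pow_zero hl t).prodMk_nhds (tendsto_div_pow_zero hl t')
  obtain ⟨n, hn⟩ := (hpair.eventually hstrict).exists
  simp only [hback n, sub_self, zero_sub, norm_neg] at hn
  set d := t / unstableEigenvalue a ^ n - t' / unstableEigenvalue a ^ n with hd
  have hn' : |d| * (2 * Real.sqrt 3) ≤ Real.sqrt 3 * |d| := by
    simpa [abs_mul, abs_of_nonneg (Real.sqrt_nonneg 3)] using hn
  have hd0 : d = 0 := by
    have : Real.sqrt 3 * |d| ≤ 0 := by linarith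
    have := nonpos_of_mul_nonpos_right this (by positivity)
    exact abs_nonpos_iff.1 this
  rw [hd, sub_eq_zero, div_left_inj' (by positivity)] at hd0
  exact hd0

/-- A zero of the derivative at `t` propagates to every `t / l^n`, and by continuity to `0`, where
the velocity is nonzero. -/
lemma deriv_curve_ne_zero {a : ℝ} (ha0 : 0 < a) (ha : a < 1 / 6) {σ : ℝ → ℝ × ℝ}
    (hσ : ContDiff ℝ ∞ σ) (h0 : HasDerivAt σ (2 - Real.sqrt 3, 1) 0)
    (hF : ∀ t, clockMap a (σ t) = σ (unstableEigenvalue a * t)) (t : ℝ) : deriv σ t ≠ 0 := by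
  have hl := one_lt_unstableEigenvalue ha0
  have hd : Differentiable ℝ σ := hσ.differentiable (by simp)
  have back : ∀ s, deriv σ (unstableEigenvalue a * s) = 0 → deriv σ s = 0 := by
    intro s hs
    have hσs := (hd s).hasDerivAt
    have hf : HasDerivAt (fun t => (σ t).1) (deriv σ s).1 s :=
      (ContinuousLinearMap.fst ℝ ℝ ℝ).hasFDerivAt.comp_hasDerivAt s hσs
    have hg : HasDerivAt (fun t => (σ t).2) (deriv σ s).2 s :=
      (ContinuousLinearMap.snd ℝ ℝ ℝ).hasFDerivAt.comp_hasDerivAt s hσs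
    have hr : HasDerivAt (fun t => σ (unstableEigenvalue a * t)) (0 : ℝ × ℝ) s := by
      have h1 := (hd (unstableEigenvalue a * s)).hasDerivAt
      rw [hs] at h1
      have h2 := h1.scomp s ((hasDerivAt_id s).const_mul (unstableEigenvalue a))
      simpa [Function.comp_def] using h2
    simp only [← hF] at hr
    have hr1 : HasDerivAt (fun t => (clockMap a (σ t)).1) 0 s :=
      (ContinuousLinearMap.fst ℝ ℝ ℝ).hasFDerivAt.comp_hasDerivAt s hr
    have hr2 : HasDerivAt (fun t => (clockMap a (σ t)).2) 0 s :=
      (ContinuousLinearMap.snd ℝ ℝ ℝ).hasFDerivAt.comp_hasDerivAt s hr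
    have e1 := hr1.unique ((hf.add (hf.sin.const_mul (2 * a))).add (hg.sin.const_mul a))
    have e2 := hr2.unique ((hg.add (hf.sin.const_mul a)).add (hg.sin.const_mul (2 * a)))
    have b1 : |Real.cos (σ s).1 * (deriv σ s).1| ≤ |(deriv σ s).1| := by
      rw [abs_mul]; exact mul_le_of_le_one_left (abs_nonneg _) (Real.abs_cos_le_one _)
    have b2 : |Real.cos (σ s).2 * (deriv σ s).2| ≤ |(deriv σ s).2| := by
      rw [abs_mul]; exact mul_le_of_le_one_left (abs_nonneg _) (Real.abs_cos_le_one _)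
    have b1' : |2 * (Real.cos (σ s).1 * (deriv σ s).1)| ≤ 2 * |(deriv σ s).1| := by
      rw [abs_mul, abs_two]; linarith
    have b2' : |2 * (Real.cos (σ s).2 * (deriv σ s).2)| ≤ 2 * |(deriv σ s).2| := by
      rw [abs_mul, abs_two]; linarith
    have h1 := abs_le_of_add_eq_zero (u := (deriv σ s).1) ha0 (by linarith [e1]) b1' b2
    have h2 := abs_le_of_add_eq_zero (u := (deriv σ s).2) ha0 (by linarith [e2]) b1 b2'
    have := eq_zero_of_dominated ha0 ha (u := (deriv σ s).1) (v := (deriv σ s).2)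
      (by linarith) (by linarith)
    exact Prod.ext this.1 this.2
  intro ht
  have hall : ∀ n : ℕ, deriv σ (t / unstableEigenvalue a ^ n) = 0 := by
    intro n
    induction n with
    | zero => simpa using ht
    | succ n ih =>
      apply back
      rw [mul_div_pow_succ hl, ih]
  have hc : Continuous (deriv σ) := hσ.continuous_deriv (by simp)
  have h1 := (hc.tendsto 0).comp (tendsto_div_pow_zero hl t)
  have h2 : deriv σ 0 = 0 :=
    tendsto_nhds_unique h1 (tendsto_const_nhds.congr fun n => (hall n).symm)
  rw [h0.deriv] at h2
  simpa using congrArg Prod.snd h2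

end Immersion

/-! ### Eigenvalues at the saddle and the sink -/

section Multipliers

/-- The Jacobian matrix of `clockMap a`. -/
noncomputable def clockJacobian (a : ℝ) (z : ℝ × ℝ) : Matrix (Fin 2) (Fin 2) ℝ :=
  !![1 + 2 * a * Real.cos z.1, a * Real.cos z.2; a * Real.cos z.1, 1 + 2 * a * Real.cos z.2]

lemma hasFDerivAt_clockMap (a : ℝ) (z : ℝ × ℝ) :
    HasFDerivAt (clockMap a) (Matrix.toLin (.finTwoProd ℝ) (.finTwoProd ℝ)
      (clockJacobian a z)).toContinuousLinearMap z := by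
  have hf : HasFDerivAt (fun z : ℝ × ℝ => Real.sin z.1) _ z :=
    (hasFDerivAt_fst (𝕜 := ℝ) (p := z)).sin
  have hg : HasFDerivAt (fun z : ℝ × ℝ => Real.sin z.2) _ z :=
    (hasFDerivAt_snd (𝕜 := ℝ) (p := z)).sin
  have h := ((hasFDerivAt_fst.add (hf.const_mul (2 * a))).add (hg.const_mul a)).prodMk
    ((hasFDerivAt_snd.add (hf.const_mul a)).add (hg.const_mul (2 * a)))
  refine h.congr_fderiv ?_
  unfold clockJacobian
  rw [Matrix.toLin_finTwoProd_toContinuousLinearMap]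
  ext <;> simp

lemma mem_multipliers_clockMap {a : ℝ} {z : ℝ × ℝ} {μ : ℂ} :
    μ ∈ multipliers (clockMap a) z ↔
      μ ^ 2 - ((clockJacobian a z).trace : ℂ) * μ + ((clockJacobian a z).det : ℂ) = 0 := by
  have h : LinearMap.charpoly (fderiv ℝ (clockMap a) z : (ℝ × ℝ) →ₗ[ℝ] (ℝ × ℝ))
      = (clockJacobian a z).charpoly := by
    rw [(hasFDerivAt_clockMap a z).fderiv, ← LinearMap.charpoly_toMatrix _ (.finTwoProd ℝ)]
    simp
  rw [multipliers, h, Polynomial.mem_aroots, Matrix.charpoly_fin_two]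
  constructor
  · intro h; simpa using h.2
  · intro h'
    refine ⟨?_, by simpa using h'⟩
    rw [← Matrix.charpoly_fin_two]
    exact (Matrix.charpoly_monic _).ne_zero

lemma isSaddle_clockMap {a : ℝ} (ha0 : 0 < a) (ha : a < 1 / 6) :
    IsSaddle (clockMap a) (Real.pi, 0) := by
  obtain ⟨s1, s2⟩ := sqrt_three_bounds
  have sq : ((Real.sqrt 3 : ℝ) : ℂ) ^ 2 = 3 := by
    rw [← Complex.ofReal_pow, Real.sq_sqrt (by norm_num)]; simp
  refine ⟨by simp [clockMap], (hasFDerivAt_clockMap a _).differentiableAt,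
    ⟨((1 - Real.sqrt 3 * a : ℝ) : ℂ), ?_, ?_⟩, ⟨((1 + Real.sqrt 3 * a : ℝ) : ℂ), ?_, ?_⟩⟩
  · rw [mem_multipliers_clockMap]
    simp [clockJacobian, Matrix.trace_fin_two, Matrix.det_fin_two]
    linear_combination (a : ℂ) ^ 2 * sq
  · rw [Complex.norm_real, Real.norm_eq_abs, abs_lt]
    constructor <;> nlinarith
  · rw [mem_multipliers_clockMap]
    simp [clockJacobian, Matrix.trace_fin_two, Matrix.det_fin_two]
    linear_combination (a : ℂ) ^ 2 * sq
  · rw [Complex.norm_real, Real.norm_eq_abs, abs_of_pos (by positivity)]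
    nlinarith

lemma isSink_clockMap {a : ℝ} (ha0 : 0 < a) (ha : a < 1 / 6) :
    IsSink (clockMap a) (Real.pi, Real.pi) := by
  refine ⟨by simp [clockMap], (hasFDerivAt_clockMap a _).differentiableAt, fun μ hμ => ?_⟩
  rw [mem_multipliers_clockMap] at hμ
  simp [clockJacobian, Matrix.trace_fin_two, Matrix.det_fin_two] at hμ
  have h : (μ - ((1 - a : ℝ) : ℂ)) * (μ - ((1 - 3 * a : ℝ) : ℂ)) = 0 := by
    push_cast
    linear_combination hμ
  rcases mul_eq_zero.1 h with h | h <;> rw [sub_eq_zero] at h <;>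
    rw [h, Complex.norm_real, Real.norm_eq_abs, abs_lt] <;> constructor <;> linarith

end Multipliers

/-! ### Dynamics in the invariant square -/

section Square

/-- The side coordinate of the square along its lower left edge, from `0` to `π / 2`. -/
noncomputable def leftCoord (z : ℝ × ℝ) : ℝ := Real.pi / 2 - (z.1 - z.2) / 2

/-- The side coordinate of the square along its lower right edge, from `0` to `π / 2`. -/
noncomputable def rightCoord (z : ℝ × ℝ) : ℝ := (z.1 + z.2) / 2 - Real.pi / 2

lemma eq_of_sideCoords (z : ℝ × ℝ) :
    z = (Real.pi - leftCoord z + rightCoord z, leftCoord z + rightCoord z) := by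
  ext <;> simp [leftCoord, rightCoord] <;> ring

lemma mem_smallSquare_iff (z : ℝ × ℝ) : z ∈ smallSquare ↔
    (0 ≤ leftCoord z ∧ leftCoord z ≤ Real.pi / 2) ∧
      (0 ≤ rightCoord z ∧ rightCoord z ≤ Real.pi / 2) := by
  simp only [smallSquare, leftCoord, rightCoord, Set.mem_ofPred_eq]
  constructor
  · rintro ⟨h1, h2, h3, h4⟩
    refine ⟨⟨?_, ?_⟩, ?_, ?_⟩ <;> linarith
  · rintro ⟨⟨h1, h2⟩, h3, h4⟩
    refine ⟨?_, ?_, ?_, ?_⟩ <;> linarith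

lemma sin_fst_eq (z : ℝ × ℝ) : Real.sin z.1 = Real.sin (leftCoord z - rightCoord z) := by
  rw [← Real.sin_pi_sub]
  congr 1
  simp only [leftCoord, rightCoord]; ring

lemma sin_snd_eq (z : ℝ × ℝ) : Real.sin z.2 = Real.sin (leftCoord z + rightCoord z) := by
  congr 1
  simp only [leftCoord, rightCoord]; ring

lemma leftCoord_clockMap (a : ℝ) (z : ℝ × ℝ) : leftCoord (clockMap a z)
    = leftCoord z + a * (Real.sin (rightCoord z) * Real.cos (leftCoord z)) := by
  have h : leftCoord (clockMap a z)
      = leftCoord z + a / 2 * (Real.sin z.2 - Real.sin z.1) := by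
    simp only [leftCoord, clockMap]; ring
  rw [h, sin_fst_eq, sin_snd_eq, Real.sin_add, Real.sin_sub]; ring

lemma rightCoord_clockMap (a : ℝ) (z : ℝ × ℝ) : rightCoord (clockMap a z)
    = rightCoord z + 3 * a * (Real.sin (leftCoord z) * Real.cos (rightCoord z)) := by
  have h : rightCoord (clockMap a z)
      = rightCoord z + 3 * a / 2 * (Real.sin z.2 + Real.sin z.1) := by
    simp only [rightCoord, clockMap]; ring
  rw [h, sin_fst_eq, sin_snd_eq, Real.sin_add, Real.sin_sub]; ring

/-- Jordan's inequality applied to `sin u` and to `cos w = sin (π/2 - w)`. The three bounds give, in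
turn, monotonicity of the side coordinates, no overshoot past the upper edges, and contraction. -/
lemma sin_mul_cos_bounds {u w : ℝ} (hu : 0 ≤ u ∧ u ≤ Real.pi / 2) (hw : 0 ≤ w ∧ w ≤ Real.pi / 2) :
    0 ≤ Real.sin u * Real.cos w ∧ Real.sin u * Real.cos w ≤ Real.pi / 2 - w ∧
      ∀ m ≤ u, 2 / Real.pi * m * (2 / Real.pi * (Real.pi / 2 - w)) ≤ Real.sin u * Real.cos w := by
  have hc : Real.cos w = Real.sin (Real.pi / 2 - w) := (Real.sin_pi_div_two_sub w).symm
  have hpi := Real.pi_pos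
  have s1 := Real.mul_le_sin hu.1 hu.2
  have c1 := Real.mul_le_sin (x := Real.pi / 2 - w) (by linarith) (by linarith)
  have c2 := Real.sin_le (x := Real.pi / 2 - w) (by linarith)
  rw [← hc] at c1 c2
  have hs0 : 0 ≤ Real.sin u := le_trans (mul_nonneg (by positivity) hu.1) s1
  have hc1 : 0 ≤ 2 / Real.pi * (Real.pi / 2 - w) := mul_nonneg (by positivity) (by linarith)
  refine ⟨mul_nonneg hs0 (hc1.trans c1), ?_, fun m hm => ?_⟩
  · calc Real.sin u * Real.cos w ≤ 1 * Real.cos w := by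
          gcongr
          · exact hc1.trans c1
          · exact Real.sin_le_one u
      _ ≤ _ := by linarith
  · refine mul_le_mul (le_trans ?_ s1) c1 hc1 hs0
    gcongr

lemma mapsTo_smallSquare {a : ℝ} (ha0 : 0 < a) (ha : a < 1 / 6) :
    Set.MapsTo (clockMap a) smallSquare smallSquare := by
  intro z hz
  rw [mem_smallSquare_iff] at hz ⊢
  obtain ⟨l0, l1, -⟩ := sin_mul_cos_bounds hz.2 hz.1
  obtain ⟨r0, r1, -⟩ := sin_mul_cos_bounds hz.1 hz.2
  rw [leftCoord_clockMap, rightCoord_clockMap]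
  refine ⟨⟨?_, ?_⟩, ?_, ?_⟩
  · have := hz.1.1; positivity
  · nlinarith [hz.1.2]
  · have := hz.2.1; positivity
  · nlinarith [hz.2.2]

lemma sideCoords_le_clockMap {a : ℝ} (ha0 : 0 < a) {z : ℝ × ℝ} (hz : z ∈ smallSquare) :
    leftCoord z ≤ leftCoord (clockMap a z) ∧ rightCoord z ≤ rightCoord (clockMap a z) := by
  rw [mem_smallSquare_iff] at hz
  have l0 := (sin_mul_cos_bounds hz.2 hz.1).1
  have r0 := (sin_mul_cos_bounds hz.1 hz.2).1
  rw [leftCoord_clockMap, rightCoord_clockMap]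
  constructor
  · have := mul_nonneg ha0.le l0; linarith
  · have := mul_nonneg ha0.le r0; linarith

lemma sideCoords_le_iterate {a : ℝ} (ha0 : 0 < a) (ha : a < 1 / 6) {z : ℝ × ℝ}
    (hz : z ∈ smallSquare) (n : ℕ) : (clockMap a)^[n] z ∈ smallSquare ∧
      leftCoord z ≤ leftCoord ((clockMap a)^[n] z) ∧
      rightCoord z ≤ rightCoord ((clockMap a)^[n] z) := by
  induction n with
  | zero => exact ⟨hz, le_rfl, le_rfl⟩
  | succ n ih =>
    rw [Function.iterate_succ_apply']
    have h := sideCoords_le_clockMap ha0 ih.1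
    exact ⟨mapsTo_smallSquare ha0 ha ih.1, ih.2.1.trans h.1, ih.2.2.trans h.2⟩

/-- Away from the two lower edges of the square, the distance to the sink contracts uniformly. -/
lemma sideCoords_iterate_contract {a m : ℝ} (ha0 : 0 < a) (ha : a < 1 / 6) (hm : 0 < m)
    (hm' : m ≤ Real.pi / 2) : ∃ c : ℝ, 0 ≤ c ∧ c < 1 ∧ ∀ z ∈ smallSquare, m ≤ leftCoord z →
      m ≤ rightCoord z → ∀ n : ℕ,
      Real.pi / 2 - leftCoord ((clockMap a)^[n] z) ≤ c ^ n * (Real.pi / 2) ∧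
      Real.pi / 2 - rightCoord ((clockMap a)^[n] z) ≤ c ^ n * (Real.pi / 2) := by
  have hpi := Real.pi_gt_three
  -- Each increment is at least `a κ` times the distance left to `π/2`; for the right coordinate the
  -- surplus in `3a` is discarded.
  set κ := 2 / Real.pi * m * (2 / Real.pi) with hκ
  have hκ0 : 0 < κ := by positivity
  have hκ1 : κ ≤ 1 := by
    have h1 : 2 / Real.pi * m ≤ 1 := by
      rw [div_mul_eq_mul_div, div_le_one (by positivity)]; linarith
    have h2 : 2 / Real.pi ≤ 1 := by rw [div_le_one (by positivity)]; linarith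
    exact mul_le_one₀ h1 (by positivity) h2
  have hc0 : 0 ≤ 1 - a * κ := by nlinarith
  refine ⟨1 - a * κ, hc0, by nlinarith, fun z hz hl hr n => ?_⟩
  induction n with
  | zero =>
    rw [mem_smallSquare_iff] at hz
    simp only [Function.iterate_zero, id_eq, pow_zero, one_mul]
    exact ⟨by linarith [hz.1.1], by linarith [hz.2.1]⟩
  | succ n ih =>
    obtain ⟨hsq, hl', hr'⟩ := sideCoords_le_iterate ha0 ha hz n
    rw [Function.iterate_succ_apply', leftCoord_clockMap, rightCoord_clockMap]
    set w := (clockMap a)^[n] z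
    rw [mem_smallSquare_iff] at hsq
    have l2 := (sin_mul_cos_bounds hsq.2 hsq.1).2.2 m (hr.trans hr')
    have r2 := (sin_mul_cos_bounds hsq.1 hsq.2).2.2 m (hl.trans hl')
    have r0 := (sin_mul_cos_bounds hsq.1 hsq.2).1
    have l3 := mul_le_mul_of_nonneg_left l2 ha0.le
    have r3 := mul_le_mul_of_nonneg_left r2 ha0.le
    have r4 := mul_nonneg ha0.le r0
    have i1 := mul_le_mul_of_nonneg_left ih.1 hc0
    have i2 := mul_le_mul_of_nonneg_left ih.2 hc0
    rw [pow_succ', mul_assoc (1 - a * κ)]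
    rw [← mul_assoc (2 / Real.pi * m), ← hκ] at l3 r3
    constructor <;> linarith

end Square

/-! ### The branch in the square and its limit -/

section Branch

lemma eventually_half_slope_le {f : ℝ → ℝ} {D : ℝ} (hf : HasDerivAt f D 0) (h0 : f 0 = 0)
    (hD : 0 < D) : ∀ᶠ t in 𝓝[>] (0 : ℝ), D / 2 * t ≤ f t := by
  have h := (hasDerivAt_iff_isLittleO.1 hf).def (c := D / 2) (by positivity)
  filter_upwards [h.filter_mono nhdsWithin_le_nhds, self_mem_nhdsWithin] with t ht ht0
  have ht0 : 0 < t := ht0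
  rw [h0, sub_zero, sub_zero, smul_eq_mul, Real.norm_eq_abs, Real.norm_eq_abs, abs_of_pos ht0] at ht
  have := (abs_le.1 ht).1
  linarith

/-- The side coordinates start with velocities `(√3 - 1)/2` and `(3 - √3)/2`, both positive. -/
lemma curve_near_saddle {σ : ℝ → ℝ × ℝ} (h0 : HasDerivAt σ (2 - Real.sqrt 3, 1) 0)
    (hp : σ 0 = (Real.pi, 0)) : ∃ d > 0, ∃ k > 0, ∀ t, 0 < t → t ≤ d →
      σ t ∈ smallSquare ∧ k * t ≤ leftCoord (σ t) ∧ k * t ≤ rightCoord (σ t) := by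
  obtain ⟨s1, s2⟩ := sqrt_three_bounds
  have hf : HasDerivAt (fun t => (σ t).1) (2 - Real.sqrt 3) 0 :=
    (ContinuousLinearMap.fst ℝ ℝ ℝ).hasFDerivAt.comp_hasDerivAt (0 : ℝ) h0
  have hg : HasDerivAt (fun t => (σ t).2) 1 0 :=
    (ContinuousLinearMap.snd ℝ ℝ ℝ).hasFDerivAt.comp_hasDerivAt (0 : ℝ) h0
  have hl : HasDerivAt (fun t => leftCoord (σ t)) ((Real.sqrt 3 - 1) / 2) 0 :=
    (((hf.sub hg).div_const 2).const_sub (Real.pi / 2)).congr_deriv (by ring)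
  have hr : HasDerivAt (fun t => rightCoord (σ t)) ((3 - Real.sqrt 3) / 2) 0 :=
    (((hf.add hg).div_const 2).sub_const (Real.pi / 2)).congr_deriv (by ring)
  have hl0 : leftCoord (σ 0) = 0 := by rw [hp]; simp [leftCoord]
  have hr0 : rightCoord (σ 0) = 0 := by rw [hp]; simp [rightCoord]
  have e1 := eventually_half_slope_le hl hl0 (by linarith)
  have e2 := eventually_half_slope_le hr hr0 (by linarith)
  have e3 : ∀ᶠ t in 𝓝[>] (0 : ℝ), leftCoord (σ t) < Real.pi / 2 :=
    (hl.continuousAt.eventually_lt continuousAt_const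
      (by rw [hl0]; positivity)).filter_mono nhdsWithin_le_nhds
  have e4 : ∀ᶠ t in 𝓝[>] (0 : ℝ), rightCoord (σ t) < Real.pi / 2 :=
    (hr.continuousAt.eventually_lt continuousAt_const
      (by rw [hr0]; positivity)).filter_mono nhdsWithin_le_nhds
  obtain ⟨d, hd, h⟩ := mem_nhdsGT_iff_exists_Ioc_subset.1
    (e1.and (e2.and (e3.and e4)))
  refine ⟨d, hd, 1 / 10, by norm_num, fun t ht htd => ?_⟩
  obtain ⟨h1, h2, h3, h4⟩ := h ⟨ht, htd⟩
  have k1 : 1 / 10 * t ≤ leftCoord (σ t) := by nlinarith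
  have k2 : 1 / 10 * t ≤ rightCoord (σ t) := by nlinarith
  refine ⟨(mem_smallSquare_iff _).2 ⟨⟨by linarith, h3.le⟩, by linarith, h4.le⟩, k1, k2⟩

variable {a : ℝ} {σ : ℝ → ℝ × ℝ}

/-- Every `t ≥ t₀` is `l^n τ` with `τ` in the fundamental domain `[e, l e)` near the saddle, and the
side coordinates never decrease along orbits in the square. -/
lemma curve_away_from_saddle (ha0 : 0 < a) (ha : a < 1 / 6)
    (h0 : HasDerivAt σ (2 - Real.sqrt 3, 1) 0) (hp : σ 0 = (Real.pi, 0))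
    (hF : ∀ t, clockMap a (σ t) = σ (unstableEigenvalue a * t)) (t₀ : ℝ) (ht₀ : 0 < t₀) :
    ∃ m > 0, ∀ t ≥ t₀, σ t ∈ smallSquare ∧ m ≤ leftCoord (σ t) ∧ m ≤ rightCoord (σ t) := by
  have hl := one_lt_unstableEigenvalue ha0
  obtain ⟨d, hd, k, hk, h⟩ := curve_near_saddle h0 hp
  set l := unstableEigenvalue a
  obtain ⟨e, he, hed, het⟩ : ∃ e > 0, l * e ≤ d ∧ e ≤ t₀ :=
    ⟨min (d / l) t₀, lt_min (by positivity) ht₀, by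
      calc l * min (d / l) t₀ ≤ l * (d / l) := by gcongr; exact min_le_left _ _
        _ = d := by field_simp, min_le_right _ _⟩
  refine ⟨k * e, by positivity, fun t ht => ?_⟩
  obtain ⟨n, hn1, hn2⟩ := exists_nat_pow_near (x := t / e) (y := l)
    (by rw [one_le_div he]; linarith) hl
  rw [le_div_iff₀ he] at hn1
  rw [div_lt_iff₀ he, pow_succ] at hn2
  have hln : 0 < l ^ n := by positivity
  have hτ1 : e ≤ t / l ^ n := by rw [le_div_iff₀ hln]; linarith
  have hτ2 : t / l ^ n ≤ d := by
    rw [div_le_iff₀ hln]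
    nlinarith
  obtain ⟨hsq, h1, h2⟩ := h _ (he.trans_le hτ1) hτ2
  have hit := sideCoords_le_iterate ha0 ha hsq n
  rw [iterate_curve hF, mul_div_cancel₀ _ hln.ne'] at hit
  have hke : k * e ≤ k * (t / l ^ n) := by gcongr
  exact ⟨hit.1, by linarith [hit.2.1], by linarith [hit.2.2]⟩

/-- For `t ≥ l^n`, the point `σ t` is the `n`-th iterate of a curve point with parameter at least
`1`, so the uniform contraction applies `n` times. -/
lemma tendsto_curve_sink (ha0 : 0 < a) (ha : a < 1 / 6)
    (h0 : HasDerivAt σ (2 - Real.sqrt 3, 1) 0) (hp : σ 0 = (Real.pi, 0))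
    (hF : ∀ t, clockMap a (σ t) = σ (unstableEigenvalue a * t)) :
    Tendsto σ atTop (𝓝 (Real.pi, Real.pi)) := by
  have hl := one_lt_unstableEigenvalue ha0
  obtain ⟨m, hm, h⟩ := curve_away_from_saddle ha0 ha h0 hp hF 1 one_pos
  have hm' : m ≤ Real.pi / 2 :=
    (h 1 le_rfl).2.1.trans ((mem_smallSquare_iff _).1 (h 1 le_rfl).1).1.2
  obtain ⟨c, hc0, hc1, hc⟩ := sideCoords_iterate_contract ha0 ha hm hm'
  have hbound : ∀ (n : ℕ) (t : ℝ), unstableEigenvalue a ^ n ≤ t →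
      Real.pi / 2 - leftCoord (σ t) ≤ c ^ n * (Real.pi / 2) ∧
      Real.pi / 2 - rightCoord (σ t) ≤ c ^ n * (Real.pi / 2) := by
    intro n t ht
    have hln : 0 < unstableEigenvalue a ^ n := by positivity
    obtain ⟨h1, h2, h3⟩ := h (t / unstableEigenvalue a ^ n) (by rw [ge_iff_le, one_le_div hln]; exact ht)
    have := hc _ h1 h2 h3 n
    rwa [iterate_curve hF, mul_div_cancel₀ _ hln.ne'] at this
  have hlim : Tendsto (fun n : ℕ => c ^ n * (Real.pi / 2)) atTop (𝓝 0) := by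
    simpa using (tendsto_pow_atTop_nhds_zero_of_lt_one hc0 hc1).mul_const (Real.pi / 2)
  have hcoord : ∀ f : ℝ × ℝ → ℝ, (∀ t ≥ 1, f (σ t) ≤ Real.pi / 2) →
      (∀ (n : ℕ) (t : ℝ), unstableEigenvalue a ^ n ≤ t →
        Real.pi / 2 - f (σ t) ≤ c ^ n * (Real.pi / 2)) →
      Tendsto (fun t => f (σ t)) atTop (𝓝 (Real.pi / 2)) := by
    intro f hf1 hf2
    rw [Metric.tendsto_atTop]
    intro ε hε
    obtain ⟨n, hn⟩ := (hlim.eventually_lt_const hε).exists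
    refine ⟨unstableEigenvalue a ^ n, fun t ht => ?_⟩
    have h1 := hf1 t ((one_le_pow₀ hl.le).trans ht)
    have h2 := hf2 n t ht
    rw [Real.dist_eq, abs_lt]
    constructor <;> linarith
  have hleft := hcoord leftCoord (fun t ht => ((mem_smallSquare_iff _).1 (h t ht).1).1.2)
    fun n t ht => (hbound n t ht).1
  have hright := hcoord rightCoord (fun t ht => ((mem_smallSquare_iff _).1 (h t ht).1).2.2)
    fun n t ht => (hbound n t ht).2
  have hlim' := ((hleft.const_sub Real.pi).add hright).prodMk_nhds (hleft.add hright)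
  have e : (Real.pi - Real.pi / 2 + Real.pi / 2, Real.pi / 2 + Real.pi / 2)
      = (Real.pi, Real.pi) := by ext <;> simp
  rw [e] at hlim'
  exact hlim'.congr fun t => (eq_of_sideCoords (σ t)).symm

lemma isHeteroclinicCurve_branch (ha0 : 0 < a) (ha : a < 1 / 6)
    (hσ : ContDiff ℝ ∞ σ) (h0 : HasDerivAt σ (2 - Real.sqrt 3, 1) 0) (hp : σ 0 = (Real.pi, 0))
    (hF : ∀ t, clockMap a (σ t) = σ (unstableEigenvalue a * t)) :
    IsHeteroclinicCurve (clockMap a) (Real.pi, 0) (Real.pi, Real.pi) (σ '' Set.Ioi 0) := by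
  have hl := one_lt_unstableEigenvalue ha0
  have hsink := tendsto_curve_sink ha0 ha h0 hp hF
  -- The exponential turns the half-line of parameters into the whole line.
  refine ⟨?_, ?_, fun t => σ (Real.exp t), ⟨?_, ?_, fun t => ?_⟩, ?_, ?_, ?_⟩
  · ext z
    constructor
    · rintro ⟨_, ⟨t, ht, rfl⟩, rfl⟩
      have ht : 0 < t := ht
      exact ⟨unstableEigenvalue a * t, by simp only [Set.mem_Ioi]; positivity, (hF t).symm⟩
    · rintro ⟨t, ht, rfl⟩
      have ht : 0 < t := ht
      refine ⟨_, ⟨t / unstableEigenvalue a, by simp only [Set.mem_Ioi]; positivity, rfl⟩, ?_⟩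
      rw [hF, mul_div_cancel₀ _ (by positivity)]
  · rintro _ ⟨t, ht, rfl⟩
    have ht : 0 < t := ht
    refine ⟨?_, ?_⟩
    · rw [← hp]
      exact range_subset_unstableSet hl hσ.continuous hF ⟨t, rfl⟩
    · simp only [stableSet, Set.mem_ofPred_eq, iterate_curve hF]
      exact hsink.comp ((tendsto_pow_atTop_atTop_of_one_lt hl).atTop_mul_const ht)
  · exact hσ.comp Real.contDiff_exp
  · exact (curve_injective ha0 ha hσ h0 hF).comp Real.exp_injective
  · have h1 := ((hσ.differentiable (by simp)) (Real.exp t)).hasDerivAt.scomp t (Real.hasDerivAt_exp t)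
    have h2 : deriv (fun t => σ (Real.exp t)) t = Real.exp t • deriv σ (Real.exp t) := h1.deriv
    rw [h2]
    exact smul_ne_zero (Real.exp_ne_zero t) (deriv_curve_ne_zero ha0 ha hσ h0 hF _)
  · rw [← Real.range_exp, ← Set.range_comp]; rfl
  · rw [← hp]
    exact (hσ.continuous.tendsto 0).comp Real.tendsto_exp_atBot
  · exact hsink.comp Real.tendsto_exp_atTop

lemma branch_eq_unstableSet_inter (ha0 : 0 < a) (ha : a < 1 / 6)
    (hσ : ContDiff ℝ ∞ σ) (h0 : HasDerivAt σ (2 - Real.sqrt 3, 1) 0) (hp : σ 0 = (Real.pi, 0))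
    (hF : ∀ t, clockMap a (σ t) = σ (unstableEigenvalue a * t))
    (hodd : ∀ t, σ (-t) = 2 • (Real.pi, (0 : ℝ)) - σ t)
    (hrange : Set.range σ = unstableSet (clockMap a) (Real.pi, 0)) :
    σ '' Set.Ioi 0 = (unstableSet (clockMap a) (Real.pi, 0) ∩ smallSquare) \ {(Real.pi, 0)} := by
  rw [← hrange]
  ext z
  constructor
  · rintro ⟨t, ht, rfl⟩
    have ht : 0 < t := ht
    obtain ⟨m, hm, h⟩ := curve_away_from_saddle ha0 ha h0 hp hF t ht
    refine ⟨⟨⟨t, rfl⟩, (h t le_rfl).1⟩, fun he => ?_⟩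
    rw [Set.mem_singleton_iff, ← hp] at he
    exact ht.ne' (curve_injective ha0 ha hσ h0 hF he)
  · rintro ⟨⟨⟨t, rfl⟩, hsq⟩, hne⟩
    refine ⟨t, ?_, rfl⟩
    rcases lt_trichotomy t 0 with ht | rfl | ht
    -- Reflection in the saddle negates the left coordinate, so for `t < 0` it is negative, outside
    -- the square.
    · obtain ⟨m, hm, h⟩ := curve_away_from_saddle ha0 ha h0 hp hF (-t) (by linarith)
      have h1 := (h (-t) le_rfl).2.1
      have h2 := ((mem_smallSquare_iff _).1 hsq).1.1
      rw [hodd] at h1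
      simp [leftCoord] at h1 h2
      linarith
    · exact absurd hp hne
    · exact ht

end Branch

end AlignedClocks

theorem theorem2 (a : ℝ) (ha0 : 0 < a) (ha : a < 1 / 6) :
    AlignedClocks.IsSaddle (AlignedClocks.clockMap a) (Real.pi, 0) ∧
    AlignedClocks.IsSink (AlignedClocks.clockMap a) (Real.pi, Real.pi) ∧
    Set.MapsTo (AlignedClocks.clockMap a) AlignedClocks.smallSquare AlignedClocks.smallSquare ∧
    ∃ C : Set (ℝ × ℝ),
      AlignedClocks.IsHeteroclinicCurve (AlignedClocks.clockMap a)
        (Real.pi, 0) (Real.pi, Real.pi) C ∧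
      AlignedClocks.IsUnstableBranch (AlignedClocks.clockMap a)
        (Real.pi, 0) (2 - Real.sqrt 3, 1) C ∧
      C = (AlignedClocks.unstableSet (AlignedClocks.clockMap a) (Real.pi, 0) ∩
        AlignedClocks.smallSquare) \ {(Real.pi, 0)} := by
  obtain ⟨σ, hσ, h0, hp, hF, hodd⟩ := AlignedClocks.exists_unstable_curve ha0 ha
  have hrange : Set.range σ = AlignedClocks.unstableSet (AlignedClocks.clockMap a) (Real.pi, 0) := by
    refine Set.Subset.antisymm ?_ (AlignedClocks.unstableSet_subset_range ha0 ha hσ h0 hp hF)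
    rw [← hp]
    exact AlignedClocks.range_subset_unstableSet
      (AlignedClocks.one_lt_unstableEigenvalue ha0) hσ.continuous hF
  exact ⟨AlignedClocks.isSaddle_clockMap ha0 ha, AlignedClocks.isSink_clockMap ha0 ha,
    AlignedClocks.mapsTo_smallSquare ha0 ha, σ '' Set.Ioi 0,
    AlignedClocks.isHeteroclinicCurve_branch ha0 ha hσ h0 hp hF,
    ⟨σ, ⟨hσ, AlignedClocks.curve_injective ha0 ha hσ h0 hF,
      AlignedClocks.deriv_curve_ne_zero ha0 ha hσ h0 hF⟩, hp, h0.deriv, hrange, rfl⟩,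
    AlignedClocks.branch_eq_unstableSet_inter ha0 ha hσ h0 hp hF hodd hrange⟩
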